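/- Let $d\ge 1$, let $B(0,r)$ be the closed Euclidean ball of radius $r$ in $\mathbb{R}^d$, and let $f:B(0,r)\to\mathbb{R}$ be continuous with a unique minimizer $x^\star$ on $B(0,r)$, where $\lVert x^\star\rVert<r$. Assume that there are a symmetric positive definite matrix $\mathbf{H}$, a real number $\alpha>2$ and a bounded function $\varepsilon$ such that, with $\lVert z\rVert_{\mathbf{H}}=\sqrt{z^T\mathbf{H}z}$, for all $x\in B(0,r)$, \[ f(x)=\lVert x-x^\star\rVert_{\mathbf{H}}^2+\lVert x-x^\star\rVert_{\mathbf{H}}^{\alpha}\,\varepsilon(x-x^\star). \] For an integer $\lambda\ge 1$ let $X_1,\dots,X_\lambda$ be independent and uniformly distributed in $B(0,r)$, let $X_{(1)},\dots,X_{(\lambda)}$ be the same points ordered so that $f(X_{(1)})\le\dots\le f(X_{(\lambda)})$ (ties being broken by any rule, depending on the sample, for which the $X_{(i)}$ are random variables), and for $1\le\mu\le\lambda$ put $\overline{X}_{(\mu)}=\frac1\mu\sum_{i=1}^{\mu}X_{(i)}$. Let $(\mu_\lambda)_{\lambda\in\mathbb{N}}$ be a sequence of integers with $\mu_\lambda\to\infty$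 and $1\le\mu_\lambda\le\lambda-1$ for all $\lambda\ge 2$. Then there are constants $C,C'>0$ and $\tilde\lambda\in\mathbb{N}$, independent of the tie-breaking rule, such that for all $\lambda\ge\tilde\lambda$ the random variable $f(\overline{X}_{(\mu_\lambda)})$ is integrable and \[ \mathbb{E}\left[f(\overline{X}_{(\mu_\lambda)})\right]\le C\,\frac{\mu_\lambda^{2(\alpha-1)/d}}{\lambda^{2(\alpha-1)/d}}+C'\,\frac{\mu_\lambda^{2/d-1}}{\lambda^{2/d}}. \] In particular, if $\mu_\lambda\sim C''\lambda^{\frac{2(\alpha-2)}{d+2(\alpha-2)}}$ as $\lambda\to\infty$ for some $C''>0$, then there is $C'''>0$, independent of $\lambda$ and of the tie-breaking rule, such that for all $\lambda\ge\tilde\lambda$ \[ \mathbb{E}\left[f(\overline{X}_{(\mu_\lambda)})\right]\le C'''\,\lambda^{-\frac{2(\alpha-1)}{d+2(\alpha-2)}}, \] and if moreover $d>2$, this beats random search: $\mathbb{E}\left[f(\overline{X}_{(\mu_\lambda)})\right]=o\left(\mathbb{E}\left[f(X_{(1)})\right]\right)$ as $\lambda\to\infty$. -/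

import Mathlib

namespace MuBest

/-- The squared `H`-norm `zᵀ H z` of a vector `z` of `ℝ^d`. -/
def sqNormH {d : ℕ} (H : Matrix (Fin d) (Fin d) ℝ) (z : EuclideanSpace ℝ (Fin d)) : ℝ :=
  z.ofLp ⬝ᵥ H.mulVec z.ofLp

/-- The class of objective functions on the closed ball `B(0,r)`. Only the values of `f` on the
ball are constrained; `xs` is the unique minimizer, and it is interior. -/
structure IsObjective {d : ℕ} (r : ℝ) (f : EuclideanSpace ℝ (Fin d) → ℝ)
    (xs : EuclideanSpace ℝ (Fin d)) (H : Matrix (Fin d) (Fin d) ℝ) (α : ℝ) : Prop where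
  continuousOn : ContinuousOn f (Metric.closedBall 0 r)
  norm_lt : ‖xs‖ < r
  unique_min : ∀ x ∈ Metric.closedBall (0 : EuclideanSpace ℝ (Fin d)) r, x ≠ xs → f xs < f x
  posDef : H.PosDef
  two_lt : 2 < α
  expansion : ∃ ε : EuclideanSpace ℝ (Fin d) → ℝ, (∃ M > 0, ∀ z, |ε z| ≤ M) ∧
    ∀ x ∈ Metric.closedBall (0 : EuclideanSpace ℝ (Fin d)) r,
      f x = sqNormH H (x - xs) + sqNormH H (x - xs) ^ (α / 2) * ε (x - xs)

/-- The uniform law on the closed ball `B(0,r)` of `ℝ^d`: normalized Lebesgue measure. -/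
noncomputable def uniformBall (d : ℕ) (r : ℝ) :
    MeasureTheory.Measure (EuclideanSpace ℝ (Fin d)) :=
  ProbabilityTheory.cond MeasureTheory.volume (Metric.closedBall 0 r)

/-- The joint law of `n` independent points drawn uniformly in `B(0,r)`. -/
noncomputable def sampleLaw (d : ℕ) (r : ℝ) (n : ℕ) :
    MeasureTheory.Measure (Fin n → EuclideanSpace ℝ (Fin d)) :=
  MeasureTheory.Measure.pi fun _ => uniformBall d r

/-- `σ` ranks every sample `x` of `n` points of the ball by increasing value of `f`, ties being
broken in any way for which the ordered points `x (σ x 0), …, x (σ x (n-1))` are random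
variables. -/
structure IsRanking {d : ℕ} (r : ℝ) (f : EuclideanSpace ℝ (Fin d) → ℝ) (n : ℕ)
    (σ : (Fin n → EuclideanSpace ℝ (Fin d)) → Equiv.Perm (Fin n)) : Prop where
  sorted : ∀ x : Fin n → EuclideanSpace ℝ (Fin d), (∀ i, x i ∈ Metric.closedBall 0 r) →
    Monotone fun i => f (x (σ x i))
  aemeasurable : ∀ i, AEMeasurable (fun x => x (σ x i)) (sampleLaw d r n)

/-- The mean of the `m` first points of the sample `x` in the order given by `σ`. -/
noncomputable def bestMean {d n : ℕ}
    (σ : (Fin n → EuclideanSpace ℝ (Fin d)) → Equiv.Perm (Fin n)) (m : ℕ)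
    (x : Fin n → EuclideanSpace ℝ (Fin d)) : EuclideanSpace ℝ (Fin d) :=
  (m : ℝ)⁻¹ • ∑ i ∈ Finset.univ.filter (fun i : Fin n => (i : ℕ) < m), x (σ x i)

/-- The expected value of `f` at the mean of the `m` best of `n` points drawn uniformly
in `B(0,r)`. For `m = 1` this is the expected value reached by random search. -/
noncomputable def expectedValue {d n : ℕ} (r : ℝ) (f : EuclideanSpace ℝ (Fin d) → ℝ)
    (σ : (Fin n → EuclideanSpace ℝ (Fin d)) → Equiv.Perm (Fin n)) (m : ℕ) : ℝ :=
  ∫ x, f (bestMean σ m x) ∂(sampleLaw d r n)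

end MuBest

/-! Write `H = LᵀL`, `a(x) = ‖L(x - x⋆)‖`, `β = α - 2`, `u = m/n`. Since `f ≤ c₁ a²` on the ball, it
suffices to bound the second moment of `∑ L(X_i - x⋆)` over the set `S` of the `m` points selected
by `f`, and to divide by `m²`. Let `T` be the set of the `m` points with smallest `a`, and `q` the
`m`-th smallest value of `a`. The sum over `S` is split into three pieces
(`norm_sum_le_of_selection`).

The sum over `T`, cut off outside an ellipsoid `a ≤ ρ` contained in the ball: reflecting a single
point at `x⋆` preserves the law and all values of `a`, hence `T`, so the cross terms vanish and the
second moment is at most `m E[q²]` (`integral_norm_sq_sum_eq_of_reflection`). The cut-off part: it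
is nonzero only if `q > ρ`, hence at most `m q (q/ρ)^β`. The exchange of `T` for `S`: the expansion
of `f` confines the points of `S \ T` to the annulus `q ≤ a ≤ q + c q^{β+1}`, whose mass is
`O(q^{d+β})`, so this piece is bounded by a multiple of `#(S \ T) q`.

The second moment of `#(S \ T) q` is a sum over pairs of points. Deleting points outside `T` does
not change `q`, so `q` may be computed from the other points, independently of the pair; integrating
the pair out leaves moments of `q`. These satisfy `E[q^p] ≤ C u^{p/d}` (`exists_ordStat_moment_le`),
by an exponential tail bound for the number of points in an ellipsoid. Altogether the second moment
is `O(m² u^{2(β+1)/d} + m u^{2/d})`.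

For random search, with probability at least `1/2` no point falls into an ellipsoid of radius of
order `n^{-1/d}`, so the expected value is at least of order `n^{-2/d}`. Only finitely valued
selections enter the upper bound, and its constants do not depend on how ties are broken. -/

namespace MuBest

open MeasureTheory Finset

/-! ### Order statistics -/

/-- The `m`-th smallest of the numbers `a j`, `j ∈ A` (zero if `A` has fewer than `m` elements). -/
noncomputable def ordStat {ι : Type*} (A : Finset ι) (m : ℕ) (a : ι → ℝ) : ℝ :=
  -- The minimum over `m`-subsets of the maximum on the subset. Working in `ENNReal` makes empty
  -- infima and suprema harmless; `ofReal` replaces negative entries by zero.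
  ((A.powersetCard m).inf fun B => B.sup fun j => ENNReal.ofReal (a j)).toReal

section OrdStat

variable {ι : Type*} {A : Finset ι} {m : ℕ} {a : ι → ℝ}

theorem ordStat_nonneg : 0 ≤ ordStat A m a := ENNReal.toReal_nonneg

theorem ordStat_congr {b : ι → ℝ} (h : ∀ j ∈ A, a j = b j) : ordStat A m a = ordStat A m b := by
  unfold ordStat
  congr 1
  refine Finset.inf_congr rfl fun B hB => Finset.sup_congr rfl fun j hj => ?_
  rw [h j ((mem_powersetCard.1 hB).1 hj)]

theorem measurable_ordStat {Ω : Type*} [MeasurableSpace Ω] {g : Ω → ι → ℝ}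
    (hg : ∀ j, Measurable fun ω => g ω j) : Measurable fun ω => ordStat A m (g ω) := by
  unfold ordStat
  simp only [Finset.inf_eq_iInf, Finset.sup_eq_iSup]
  refine Measurable.ennreal_toReal ?_
  refine Measurable.biInf _ (Finset.countable_toSet _) fun B _ => ?_
  exact Measurable.biSup _ (Finset.countable_toSet _) fun j _ => (hg j).ennreal_ofReal

theorem card_le_of_lt_ordStat {t : ℝ} (ht : 0 ≤ t) (h : t < ordStat A m a) :
    #{j ∈ A | a j ≤ t} < m := by
  by_contra! hc
  obtain ⟨B, hBs, hB⟩ := exists_subset_card_eq hc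
  refine absurd h (not_lt.2 ?_)
  refine ENNReal.toReal_le_of_le_ofReal ht ?_
  refine (Finset.inf_le (b := B) ?_).trans (Finset.sup_le fun j hj => ?_)
  · exact mem_powersetCard.2 ⟨hBs.trans (filter_subset _ _), hB⟩
  · exact ENNReal.ofReal_le_ofReal (mem_filter.1 (hBs hj)).2

theorem ordStat_le {R : ℝ} (hR : 0 ≤ R) (h : ∀ j ∈ A, a j ≤ R) : ordStat A m a ≤ R := by
  by_contra! hlt
  have h1 := card_le_of_lt_ordStat hR hlt
  rw [filter_true_of_mem h] at h1
  -- With fewer than `m` indices the infimum is `⊤`, which `toReal` sends to zero.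
  have h2 : A.powersetCard m = ∅ := powersetCard_eq_empty.2 h1
  simp only [ordStat, h2, Finset.inf_empty, ENNReal.toReal_top] at hlt
  linarith

/-- An `m`-subset other than `T` has an element outside `T`, whose entry dominates every entry on
`T`. As `A` is any set containing `T`, deleting indices outside `T` leaves the order statistic
unchanged; this makes the leave-one-out argument possible. -/
theorem ordStat_eq_of_lower {T : Finset ι} (hTA : T ⊆ A) (hT : #T = m)
    (hlow : ∀ i ∈ T, ∀ j ∈ A, j ∉ T → a i ≤ a j) :
    ordStat A m a = (T.sup fun j => ENNReal.ofReal (a j)).toReal := by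
  unfold ordStat
  congr 1
  apply le_antisymm
  · exact Finset.inf_le (f := fun B => B.sup fun j => ENNReal.ofReal (a j))
      (mem_powersetCard.2 ⟨hTA, hT⟩)
  · refine Finset.le_inf fun B hB => ?_
    obtain ⟨hBA, hBc⟩ := mem_powersetCard.1 hB
    by_cases hBT : B ⊆ T
    · rw [eq_of_subset_of_card_le hBT (by omega)]
    · obtain ⟨j, hjB, hjT⟩ := not_subset.1 hBT
      refine Finset.sup_le fun i hi => ?_
      exact (ENNReal.ofReal_le_ofReal (hlow i hi j (hBA hjB) hjT)).trans
        (Finset.le_sup (f := fun j => ENNReal.ofReal (a j)) hjB)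

theorem le_ordStat_of_lower {T : Finset ι} (hTA : T ⊆ A) (hT : #T = m)
    (hlow : ∀ i ∈ T, ∀ j ∈ A, j ∉ T → a i ≤ a j) {i : ι} (hi : i ∈ T) :
    a i ≤ ordStat A m a := by
  rw [ordStat_eq_of_lower hTA hT hlow]
  have hne : (T.sup fun j => ENNReal.ofReal (a j)) ≠ ⊤ := by
    refine ((Finset.sup_lt_iff (by simp)).2 fun j _ => ENNReal.ofReal_lt_top).ne
  refine (le_max_left _ 0).trans ?_
  rw [← ENNReal.toReal_ofReal']
  exact ENNReal.toReal_mono hne (Finset.le_sup (f := fun j => ENNReal.ofReal (a j)) hi)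

theorem ordStat_le_of_lower {T : Finset ι} (hTA : T ⊆ A) (hT : #T = m)
    (hlow : ∀ i ∈ T, ∀ j ∈ A, j ∉ T → a i ≤ a j) {j : ι} (hjA : j ∈ A) (hj : j ∉ T)
    (h0 : 0 ≤ a j) : ordStat A m a ≤ a j := by
  rw [ordStat_eq_of_lower hTA hT hlow]
  refine ENNReal.toReal_le_of_le_ofReal h0 (Finset.sup_le fun i hi => ?_)
  exact ENNReal.ofReal_le_ofReal (hlow i hi j hjA hj)

end OrdStat

/-! ### Counting points of an independent sample -/

section Product

variable {E : Type*} [MeasurableSpace E] {ν : Measure E} [IsProbabilityMeasure ν]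
  {ι : Type*} [Fintype ι]

/-- Fubini in the single coordinate `i`, the other coordinates being frozen. -/
theorem lintegral_pi_le_of_update [DecidableEq ι] {F G : (ι → E) → ENNReal} (hF : Measurable F)
    (hG : Measurable G) (i : ι) (hGi : ∀ x y, G (Function.update x i y) = G x)
    (h : ∀ x, ∫⁻ y, F (Function.update x i y) ∂ν ≤ G x) :
    ∫⁻ x, F x ∂(Measure.pi fun _ : ι => ν) ≤ ∫⁻ x, G x ∂(Measure.pi fun _ : ι => ν) := by
  refine lintegral_le_of_lmarginal_le {i} hF hG ?_
  rw [lmarginal_singleton, lmarginal_singleton]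
  intro x
  simpa [hGi] using h x

/-- A Chernoff bound: Markov's inequality for `2^{-N}`, `N` being the number of points of `A` with
`a ≤ t`. By independence its expectation is `(1 - F/2)^{#A}`, with `F` the mass of `a ≤ t`. -/
theorem measure_card_lt_le {a : E → ℝ} (ha : Measurable a) (A : Finset ι) (m : ℕ) (t : ℝ) :
    (Measure.pi fun _ : ι => ν).real {x | #{j ∈ A | a (x j) ≤ t} < m} ≤
      2 ^ m * Real.exp (-(#A * ν.real {y | a y ≤ t} / 2)) := by
  classical
  set π := Measure.pi fun _ : ι => ν
  set F := ν.real {y | a y ≤ t}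
  have hms : MeasurableSet {y | a y ≤ t} := ha measurableSet_Iic
  -- The product of the `g j (x j)` equals `2^{-N}`.
  let g : ι → E → ℝ := fun j y => if j ∈ A then (1 - {y | a y ≤ t}.indicator (fun _ => 1 / 2) y) else 1
  have hgm : ∀ j, Measurable (g j) := by
    intro j
    by_cases hj : j ∈ A
    · simp only [g, hj, if_true]
      exact measurable_const.sub (measurable_const.indicator hms)
    · simp only [g, hj, if_false]; exact measurable_const
  have hg0 : ∀ j y, 0 ≤ g j y ∧ g j y ≤ 1 := by
    intro j y
    simp only [g, Set.indicator_apply]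
    split_ifs <;> norm_num
  have hint : ∫ x, ∏ j, g j (x j) ∂π = (1 - F / 2) ^ #A := by
    rw [integral_fintype_prod_eq_prod]
    rw [← Finset.prod_subset (subset_univ A)]
    · rw [← Finset.prod_const]
      refine Finset.prod_congr rfl fun j hj => ?_
      simp only [g, hj, if_true]
      rw [integral_sub (integrable_const _) ((integrable_const _).indicator hms),
        integral_indicator hms]
      simp [F]
      ring
    · intro j _ hj
      simp [g, hj]
  have hpm : Measurable fun x : ι → E => ∏ j, g j (x j) :=
    Finset.measurable_prod _ fun j _ => (hgm j).comp (measurable_pi_apply j)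
  have hpi : Integrable (fun x : ι → E => ∏ j, g j (x j)) π := by
    refine Integrable.of_bound hpm.aestronglyMeasurable 1 (ae_of_all _ fun x => ?_)
    rw [Real.norm_of_nonneg (prod_nonneg fun j _ => (hg0 j _).1)]
    exact prod_le_one (fun j _ => (hg0 j _).1) fun j _ => (hg0 j _).2
  have hmark := mul_meas_ge_le_integral_of_nonneg (μ := π)
    (ae_of_all _ fun x => prod_nonneg fun j _ => (hg0 j (x j)).1) hpi ((1 / 2 : ℝ) ^ m)
  have hsub : {x : ι → E | #{j ∈ A | a (x j) ≤ t} < m} ⊆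
      {x | (1 / 2 : ℝ) ^ m ≤ ∏ j, g j (x j)} := by
    intro x hx
    have : ∏ j, g j (x j) = (1 / 2 : ℝ) ^ #{j ∈ A | a (x j) ≤ t} := by
      rw [← Finset.prod_subset (subset_univ {j ∈ A | a (x j) ≤ t})]
      · rw [← Finset.prod_const]
        refine Finset.prod_congr rfl fun j hj => ?_
        obtain ⟨h1, h2⟩ := mem_filter.1 hj
        simp [g, h1, h2]
        norm_num
      · intro j _ hj
        by_cases h1 : j ∈ A
        · have h2 : ¬ a (x j) ≤ t := fun h2 => hj (mem_filter.2 ⟨h1, h2⟩)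
          simp [g, h1, h2]
        · simp [g, h1]
    simp only [Set.mem_ofPred_eq] at hx ⊢
    rw [this]
    exact pow_le_pow_of_le_one (by norm_num) (by norm_num) hx.le
  have hF1 : F ≤ 1 := measureReal_le_one
  have hexp : (1 - F / 2) ^ #A ≤ Real.exp (-(#A * F / 2)) := by
    have h1 : 1 - F / 2 ≤ Real.exp (-(F / 2)) := by
      have := Real.add_one_le_exp (-(F / 2)); linarith
    calc (1 - F / 2) ^ #A ≤ Real.exp (-(F / 2)) ^ #A :=
          pow_le_pow_left₀ (by linarith) h1 _
      _ = _ := by rw [← Real.exp_nat_mul]; congr 1; ring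
  have h2 : (1 / 2 : ℝ) ^ m * π.real {x | #{j ∈ A | a (x j) ≤ t} < m} ≤
      Real.exp (-(#A * F / 2)) := by
    refine le_trans ?_ (hmark.trans (hint.le.trans hexp))
    exact mul_le_mul_of_nonneg_left (measureReal_mono hsub) (by positivity)
  rw [one_div, inv_pow, inv_mul_le_iff₀ (by positivity)] at h2
  exact h2

end Product

end MuBest

namespace MuBest

open MeasureTheory Finset

/-! ### Tails and moments of the order statistic -/

/-- At `t = τ (m/n)^{1/d}` the expected count is at least `κ τ^d m / 2`, so the Chernoff bound is
the `m`-th power of the right-hand side. -/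
theorem measure_lt_ordStat_le {E : Type*} [MeasurableSpace E] {ν : Measure E}
    [IsProbabilityMeasure ν] {a : E → ℝ} (ha : Measurable a) {d : ℕ} (hd : 1 ≤ d) {κ R : ℝ}
    (hκ : 0 ≤ κ) (hR0 : 0 ≤ R) (hR : ∀ᵐ y ∂ν, a y ≤ R)
    (hF : ∀ t, 0 ≤ t → t ≤ R → κ * t ^ d ≤ ν.real {y | a y ≤ t})
    {n m : ℕ} {A : Finset (Fin n)} (hm : 1 ≤ m) (hn : 1 ≤ n) (hA : n ≤ 2 * #A) {τ : ℝ}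
    (hτ : 0 ≤ τ) :
    (Measure.pi fun _ : Fin n => ν).real
      {x | τ * ((m : ℝ) / n) ^ (1 / d : ℝ) < ordStat A m fun j => a (x j)} ≤
      2 * Real.exp (-(κ / 4) * τ ^ (d : ℝ)) := by
  have hm' : (1 : ℝ) ≤ m := by exact_mod_cast hm
  have hn' : (1 : ℝ) ≤ n := by exact_mod_cast hn
  have hA' : (n : ℝ) ≤ 2 * #A := by exact_mod_cast hA
  have hd' : (d : ℝ) ≠ 0 := by positivity
  set s : ℝ := ((m : ℝ) / n) ^ (1 / d : ℝ)
  have hs0 : 0 ≤ s := by positivity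
  have hsd : s ^ d = m / n := by
    rw [← Real.rpow_natCast, ← Real.rpow_mul (by positivity), one_div_mul_cancel hd', Real.rpow_one]
  have ht0 : 0 ≤ τ * s := by positivity
  rcases le_or_gt (τ * s) R with htR | htR
  · set P := (Measure.pi fun _ : Fin n => ν).real {x | τ * s < ordStat A m fun j => a (x j)}
    have h1 : P ≤ (2 * Real.exp (-(κ / 4) * τ ^ (d : ℝ))) ^ m := by
      calc P ≤ (Measure.pi fun _ : Fin n => ν).real {x | #{j ∈ A | a (x j) ≤ τ * s} < m} :=
            measureReal_mono fun x hx => card_le_of_lt_ordStat ht0 hx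
        _ ≤ 2 ^ m * Real.exp (-(#A * ν.real {y | a y ≤ τ * s} / 2)) :=
            measure_card_lt_le ha A m _
        _ ≤ 2 ^ m * Real.exp (m * (-(κ / 4) * τ ^ (d : ℝ))) := by
            gcongr
            have h2 := hF _ ht0 htR
            rw [mul_pow, hsd] at h2
            rw [Real.rpow_natCast]
            have h3 : (n : ℝ) / 2 * (κ * (τ ^ d * (m / n))) ≤ #A * ν.real {y | a y ≤ τ * s} := by
              gcongr; linarith
            have h4 : (n : ℝ) / 2 * (κ * (τ ^ d * (m / n))) = m * κ * τ ^ d / 2 := by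
              field_simp
            nlinarith
        _ = _ := by rw [mul_pow, ← Real.exp_nat_mul]
    -- A base at most one dominates its `m`-th power; otherwise the bound exceeds one and is
    -- trivial. Either way the dependence on `m` disappears.
    rcases le_or_gt (2 * Real.exp (-(κ / 4) * τ ^ (d : ℝ))) 1 with h | h
    · exact h1.trans (pow_le_of_le_one (by positivity) h (by omega))
    · exact measureReal_le_one.trans h.le
  · have : (Measure.pi fun _ : Fin n => ν).real
        {x | τ * s < ordStat A m fun j => a (x j)} = 0 := by
      rw [measureReal_eq_zero_iff]
      have hae : ∀ᵐ x ∂(Measure.pi fun _ : Fin n => ν), ∀ j, a (x j) ≤ R :=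
        ae_all_iff.2 fun j =>
          (measurePreserving_eval (fun _ : Fin n => ν) j).quasiMeasurePreserving.ae hR
      refine measure_mono_null (fun x hx => ?_) hae
      intro hj
      exact absurd (ordStat_le hR0 fun j _ => hj j) (not_le.2 (htR.trans hx))
    rw [this]
    positivity

/-- The tail at scale `s = (m/n)^{1/d}` is bounded uniformly in `n`, `m` and `A`, and is integrated
by the layer cake formula. The condition `n ≤ 2 * #A` leaves room for deleting one or two points. -/
theorem exists_ordStat_moment_le {E : Type*} [MeasurableSpace E] {ν : Measure E}
    [IsProbabilityMeasure ν] {a : E → ℝ} (ha : Measurable a) {d : ℕ} (hd : 1 ≤ d) {κ R : ℝ}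
    (hκ : 0 < κ) (hR0 : 0 ≤ R) (hR : ∀ᵐ y ∂ν, a y ≤ R)
    (hF : ∀ t, 0 ≤ t → t ≤ R → κ * t ^ d ≤ ν.real {y | a y ≤ t}) {p : ℝ} (hp : 0 < p) :
    ∃ C > 0, ∀ (n m : ℕ) (A : Finset (Fin n)), 1 ≤ m → 1 ≤ n → n ≤ 2 * #A →
      ∫⁻ x, ENNReal.ofReal ((ordStat A m fun j => a (x j)) ^ p) ∂(Measure.pi fun _ : Fin n => ν) ≤
        ENNReal.ofReal (C * ((m : ℝ) / n) ^ (p / d)) := by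
  have hd' : (0 : ℝ) < d := by positivity
  have hI := integrableOn_rpow_mul_exp_neg_mul_rpow (p := d) (s := p - 1) (b := κ / 4)
    (by linarith) hd' (by positivity)
  set J := ∫ t in Set.Ioi (0 : ℝ), t ^ (p - 1) * Real.exp (-(κ / 4) * t ^ (d : ℝ))
  have hJ0 : 0 ≤ J := setIntegral_nonneg measurableSet_Ioi fun t ht => by
    have : (0 : ℝ) < t := ht
    positivity
  refine ⟨p * (2 * J) + 1, by positivity, fun n m A hm hn hA => ?_⟩
  have hm' : (1 : ℝ) ≤ m := by exact_mod_cast hm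
  have hn' : (1 : ℝ) ≤ n := by exact_mod_cast hn
  set π := Measure.pi fun _ : Fin n => ν
  set s : ℝ := ((m : ℝ) / n) ^ (1 / d : ℝ) with hs
  have hs0 : 0 < s := by positivity
  set q : (Fin n → E) → ℝ := fun x => ordStat A m fun j => a (x j)
  have hqm : Measurable q := measurable_ordStat fun j => ha.comp (measurable_pi_apply j)
  have hq0 : ∀ x, 0 ≤ q x := fun x => ordStat_nonneg
  have hsp : s ^ p = ((m : ℝ) / n) ^ (p / d) := by
    rw [hs, ← Real.rpow_mul (by positivity)]; congr 1; ring
  have h1 := lintegral_rpow_eq_lintegral_meas_lt_mul π (f := fun x => q x / s)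
    (ae_of_all _ fun x => div_nonneg (hq0 x) hs0.le) (hqm.div_const s).aemeasurable hp
  have h2 : ∫⁻ t in Set.Ioi (0 : ℝ), π {x | t < q x / s} * ENNReal.ofReal (t ^ (p - 1)) ≤
      ENNReal.ofReal (2 * J) := by
    calc _ ≤ ∫⁻ t in Set.Ioi (0 : ℝ), ENNReal.ofReal
          (2 * (t ^ (p - 1) * Real.exp (-(κ / 4) * t ^ (d : ℝ)))) := by
          refine setLIntegral_mono' measurableSet_Ioi fun t ht => ?_
          have ht0 : (0 : ℝ) < t := ht
          have h3 := measure_lt_ordStat_le ha hd hκ.le hR0 hR hF hm hn hA ht0.le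
          have h4 : {x | t < q x / s} = {x | t * s < q x} := by
            ext x; exact lt_div_iff₀ hs0
          rw [h4, ← ofReal_measureReal, ← ENNReal.ofReal_mul measureReal_nonneg]
          refine ENNReal.ofReal_le_ofReal ?_
          calc _ ≤ 2 * Real.exp (-(κ / 4) * t ^ (d : ℝ)) * t ^ (p - 1) := by gcongr
            _ = _ := by ring
      _ = ENNReal.ofReal (2 * J) := by
          rw [← ofReal_integral_eq_lintegral_ofReal (hI.const_mul 2), integral_const_mul]
          exact (ae_restrict_iff' measurableSet_Ioi).2 (ae_of_all _ fun t ht => by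
            have : (0 : ℝ) < t := ht
            show 0 ≤ 2 * (t ^ (p - 1) * Real.exp (-(κ / 4) * t ^ (d : ℝ)))
            positivity)
  calc ∫⁻ x, ENNReal.ofReal (q x ^ p) ∂π
      = ∫⁻ x, ENNReal.ofReal (s ^ p) * ENNReal.ofReal ((q x / s) ^ p) ∂π := by
        refine lintegral_congr fun x => ?_
        rw [← ENNReal.ofReal_mul (by positivity), ← Real.mul_rpow hs0.le
          (div_nonneg (hq0 x) hs0.le), mul_div_cancel₀ _ hs0.ne']
    _ = ENNReal.ofReal (s ^ p) * (ENNReal.ofReal p *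
          ∫⁻ t in Set.Ioi (0 : ℝ), π {x | t < q x / s} * ENNReal.ofReal (t ^ (p - 1))) := by
        rw [lintegral_const_mul' _ _ ENNReal.ofReal_ne_top, h1]
    _ ≤ ENNReal.ofReal (s ^ p) * (ENNReal.ofReal p * ENNReal.ofReal (2 * J)) := by gcongr
    _ = ENNReal.ofReal (s ^ p * (p * (2 * J))) := by
        rw [ENNReal.ofReal_mul (p := s ^ p) (by positivity), ENNReal.ofReal_mul hp.le]
    _ ≤ _ := by
        refine ENNReal.ofReal_le_ofReal ?_
        rw [← hsp]
        have : 0 < s ^ p := by positivity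
        nlinarith

end MuBest

namespace MuBest

open MeasureTheory Finset

/-! ### The quadratic form and the mass of its ellipsoids -/

open scoped MatrixOrder in
theorem exists_sqNormH_eq_norm_sq {d : ℕ} {H : Matrix (Fin d) (Fin d) ℝ} (hH : H.PosDef) :
    ∃ L : EuclideanSpace ℝ (Fin d) ≃L[ℝ] EuclideanSpace ℝ (Fin d),
      ∀ z, sqNormH H z = ‖L z‖ ^ 2 := by
  obtain ⟨B, hB⟩ := CStarAlgebra.nonneg_iff_eq_star_mul_self.mp hH.posSemidef.nonneg
  have key : ∀ z, sqNormH H z = ‖Matrix.toEuclideanLin B z‖ ^ 2 := by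
    intro z
    rw [EuclideanSpace.real_norm_sq_eq, sqNormH, hB, ← Matrix.mulVec_mulVec,
      Matrix.dotProduct_mulVec, Matrix.star_eq_conjTranspose,
      Matrix.conjTranspose_eq_transpose_of_trivial, Matrix.vecMul_transpose]
    simp [dotProduct, Matrix.toEuclideanLin, sq]
  have hinj : Function.Injective (Matrix.toEuclideanLin B) := by
    rw [injective_iff_map_eq_zero]
    intro z hz
    by_contra hne
    have h1 := key z
    rw [hz, norm_zero, sqNormH] at h1
    have h2 := hH.dotProduct_mulVec_pos (x := z.ofLp) (fun h => hne (by ext i; simp [h]))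
    simp only [star_trivial] at h2
    simp [h1] at h2
  refine ⟨(LinearEquiv.ofInjectiveEndo _ hinj).toContinuousLinearEquiv, fun z => ?_⟩
  rw [key]
  rfl

variable {d : ℕ}

theorem exists_volume_ellipsoid_eq (L : EuclideanSpace ℝ (Fin d) ≃L[ℝ] EuclideanSpace ℝ (Fin d))
    (xs : EuclideanSpace ℝ (Fin d)) :
    ∃ v > 0, ∀ t : ℝ, 0 ≤ t → volume.real {x | ‖L (x - xs)‖ ≤ t} = v * t ^ d ∧
      volume {x | ‖L (x - xs)‖ ≤ t} ≠ ⊤ := by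
  obtain ⟨c, hc0, hc⟩ : ∃ c : ℝ, 0 < c ∧ ∀ s : Set (EuclideanSpace ℝ (Fin d)),
      volume (L ⁻¹' s) = ENNReal.ofReal c * volume s :=
    ⟨_, abs_pos.2 (LinearEquiv.isUnit_det' L.symm.toLinearEquiv).ne_zero,
      Measure.addHaar_preimage_continuousLinearEquiv volume L⟩
  refine ⟨c * volume.real (Metric.ball (0 : EuclideanSpace ℝ (Fin d)) 1), ?_, fun t ht => ?_⟩
  · refine mul_pos hc0 ?_
    exact ENNReal.toReal_pos (Metric.measure_ball_pos _ _ one_pos).ne' measure_ball_lt_top.ne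
  · have h : volume {x | ‖L (x - xs)‖ ≤ t} = ENNReal.ofReal c *
        (ENNReal.ofReal (t ^ d) * volume (Metric.ball (0 : EuclideanSpace ℝ (Fin d)) 1)) := by
      have h1 : {x | ‖L (x - xs)‖ ≤ t} = (fun x => x - xs) ⁻¹' (L ⁻¹' Metric.closedBall 0 t) := by
        ext x; simp
      rw [h1, (measurePreserving_sub_right volume xs).measure_preimage_emb
        (Homeomorph.subRight xs).measurableEmbedding, hc, Measure.addHaar_closedBall _ _ ht,
        finrank_euclideanSpace_fin]
    constructor
    · rw [Measure.real, h, ENNReal.toReal_mul, ENNReal.toReal_mul,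
        ENNReal.toReal_ofReal hc0.le, ENNReal.toReal_ofReal (by positivity), Measure.real]
      ring
    · rw [h]
      exact ENNReal.mul_ne_top ENNReal.ofReal_ne_top
        (ENNReal.mul_ne_top ENNReal.ofReal_ne_top measure_ball_lt_top.ne)

theorem isProbabilityMeasure_uniformBall {r : ℝ} (hr : 0 < r) :
    IsProbabilityMeasure (uniformBall d r) :=
  ProbabilityTheory.cond_isProbabilityMeasure_of_finite
    (Metric.measure_closedBall_pos _ _ hr).ne' measure_closedBall_lt_top.ne

theorem ae_mem_closedBall (d : ℕ) (r : ℝ) : ∀ᵐ x ∂(uniformBall d r), x ∈ Metric.closedBall 0 r :=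
  ProbabilityTheory.ae_cond_mem measurableSet_closedBall

theorem uniformBall_real_apply (r : ℝ) (s : Set (EuclideanSpace ℝ (Fin d))) :
    (uniformBall d r).real s = (volume.real (Metric.closedBall (0 : EuclideanSpace ℝ (Fin d)) r))⁻¹ *
      volume.real (Metric.closedBall 0 r ∩ s) := by
  rw [uniformBall, Measure.real, ProbabilityTheory.cond_apply measurableSet_closedBall,
    ENNReal.toReal_mul, ENNReal.toReal_inv]
  rfl

/-- As `xs` is interior, a small ellipsoid around it lies in the ball, which gives the lower bound.
The upper bounds hold because intersecting with the ball only decreases volume. -/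
theorem exists_uniformBall_ellipsoid_bounds
    (L : EuclideanSpace ℝ (Fin d) ≃L[ℝ] EuclideanSpace ℝ (Fin d))
    {xs : EuclideanSpace ℝ (Fin d)} {r : ℝ} (hxs : ‖xs‖ < r) :
    ∃ V > 0, ∃ κ > 0, ∃ R > 0, ∃ ρ > 0,
      (∀ x, ‖L (x - xs)‖ ≤ ρ → x ∈ Metric.closedBall 0 r) ∧
      (∀ x ∈ Metric.closedBall 0 r, ‖L (x - xs)‖ ≤ R) ∧
      (∀ t, 0 ≤ t → t ≤ R → κ * t ^ d ≤ (uniformBall d r).real {x | ‖L (x - xs)‖ ≤ t}) ∧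
      (∀ t, 0 ≤ t → (uniformBall d r).real {x | ‖L (x - xs)‖ ≤ t} ≤ V * t ^ d) ∧
      (∀ s t, 0 ≤ s → s ≤ t →
        (uniformBall d r).real {x | s < ‖L (x - xs)‖ ∧ ‖L (x - xs)‖ ≤ t} ≤
          V * (t ^ d - s ^ d)) := by
  have hr : 0 < r := (norm_nonneg _).trans_lt hxs
  obtain ⟨v, hv, hvol⟩ := exists_volume_ellipsoid_eq L xs
  set b := volume.real (Metric.closedBall (0 : EuclideanSpace ℝ (Fin d)) r) with hbdef
  have hb : 0 < b :=
    ENNReal.toReal_pos (Metric.measure_closedBall_pos _ _ hr).ne' measure_closedBall_lt_top.ne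
  obtain ⟨K, hK0, hK⟩ : ∃ K > 0, ∀ y, ‖L.symm y‖ ≤ K * ‖y‖ :=
    (L.symm : EuclideanSpace ℝ (Fin d) →L[ℝ] EuclideanSpace ℝ (Fin d)).bound
  obtain ⟨K', hK0', hK'⟩ : ∃ K > 0, ∀ y, ‖L y‖ ≤ K * ‖y‖ :=
    (L : EuclideanSpace ℝ (Fin d) →L[ℝ] EuclideanSpace ℝ (Fin d)).bound
  set R := K' * (r + ‖xs‖)
  have hR : 0 < R := by positivity
  set ρ' := (r - ‖xs‖) / K
  have hρ' : 0 < ρ' := div_pos (by linarith) hK0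
  -- The radius `ρ'` keeps the ellipsoid in the ball; the minimum with `R` ensures `ρ / R ≤ 1`.
  set ρ := min ρ' R
  have hρ : 0 < ρ := lt_min hρ' hR
  have hsub : ∀ x, ‖L (x - xs)‖ ≤ ρ → x ∈ Metric.closedBall 0 r := by
    intro x hx
    have h1 : ‖x - xs‖ ≤ r - ‖xs‖ := by
      have := hK (L (x - xs))
      rw [L.symm_apply_apply] at this
      calc ‖x - xs‖ ≤ K * ‖L (x - xs)‖ := this
        _ ≤ K * ρ' := by gcongr; exact hx.trans (min_le_left _ _)
        _ = _ := mul_div_cancel₀ _ hK0.ne'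
    rw [mem_closedBall_zero_iff]
    have := norm_add_le (x - xs) xs
    rw [sub_add_cancel] at this
    linarith
  refine ⟨v / b, by positivity, v * ρ ^ d / (R ^ d * b), by positivity, R, hR, ρ, hρ, hsub,
    ?_, ?_, ?_, ?_⟩
  · intro x hx
    rw [mem_closedBall_zero_iff] at hx
    refine (hK' _).trans (mul_le_mul_of_nonneg_left ?_ hK0'.le)
    exact (norm_sub_le _ _).trans (by linarith)
  · intro t ht htR
    -- For `t ≤ R` the ellipsoid shrunk by `ρ / R` lies in the ball, at the cost of the factor `(ρ /
    -- R)^d` in `κ`.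
    set t' := t * (ρ / R)
    have ht't : t' ≤ t := mul_le_of_le_one_right ht ((div_le_one hR).2 (min_le_right _ _))
    have ht'ρ : t' ≤ ρ := by
      calc t' ≤ R * (ρ / R) := mul_le_mul_of_nonneg_right htR (by positivity)
        _ = ρ := mul_div_cancel₀ _ hR.ne'
    have ht'0 : 0 ≤ t' := by positivity
    rw [uniformBall_real_apply, ← hbdef]
    have h1 : v * t' ^ d ≤
        volume.real (Metric.closedBall 0 r ∩ {x | ‖L (x - xs)‖ ≤ t}) := by
      rw [← (hvol t' ht'0).1]
      refine measureReal_mono (fun x hx => ⟨hsub x (le_trans hx ht'ρ), le_trans hx ht't⟩) ?_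
      exact measure_ne_top_of_subset Set.inter_subset_left measure_closedBall_lt_top.ne
    calc _ = b⁻¹ * (v * t' ^ d) := by
          simp only [t', mul_pow, div_pow]; field_simp
      _ ≤ _ := by gcongr
  · intro t ht
    rw [uniformBall_real_apply, ← hbdef]
    calc _ ≤ b⁻¹ * volume.real {x | ‖L (x - xs)‖ ≤ t} := by
          gcongr
          · exact (hvol t ht).2
          · exact Set.inter_subset_right
      _ = _ := by rw [(hvol t ht).1]; ring
  · intro s t hs hst
    rw [uniformBall_real_apply, ← hbdef]
    have hms : ∀ u : ℝ, MeasurableSet {x | ‖L (x - xs)‖ ≤ u} := fun u =>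
      measurableSet_le (by fun_prop) measurable_const
    have h1 : {x | s < ‖L (x - xs)‖ ∧ ‖L (x - xs)‖ ≤ t} =
        {x | ‖L (x - xs)‖ ≤ t} \ {x | ‖L (x - xs)‖ ≤ s} := by
      ext x; simp [and_comm]
    have h2 : volume.real {x | s < ‖L (x - xs)‖ ∧ ‖L (x - xs)‖ ≤ t} = v * t ^ d - v * s ^ d := by
      have hss : {x | ‖L (x - xs)‖ ≤ s} ⊆ {x | ‖L (x - xs)‖ ≤ t} := fun x hx => le_trans hx hst
      rw [h1, measureReal_sdiff hss (hms s) (hvol t (hs.trans hst)).2, (hvol t (hs.trans hst)).1, (hvol s hs).1]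
    calc _ ≤ b⁻¹ * volume.real {x | s < ‖L (x - xs)‖ ∧ ‖L (x - xs)‖ ≤ t} := by
          gcongr
          · exact measure_ne_top_of_subset (fun x hx => hx.2) (hvol t (hs.trans hst)).2
          · exact Set.inter_subset_right
      _ = _ := by rw [h2]; ring

/-- The annulus `q ≤ a ≤ q + c q^{β+1}` has mass of order `q^{d+β}`. -/
theorem exists_annulus_le (hd : 1 ≤ d) {c R V β : ℝ} (hc : 0 ≤ c) (hR : 0 < R) (hV : 0 < V)
    (hβ : 0 < β) {E : Type*} [MeasurableSpace E] {ν : Measure E} [IsProbabilityMeasure ν] {a : E → ℝ}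
    (haR : ∀ᵐ y ∂ν, a y ≤ R)
    (hann : ∀ s t, 0 ≤ s → s ≤ t → ν.real {x | s < a x ∧ a x ≤ t} ≤ V * (t ^ d - s ^ d)) :
    ∃ K > 0, ∀ q, 0 < q →
      ν.real {x | q ≤ a x ∧ a x ≤ q + c * q ^ (β + 1)} ≤ K * q ^ (d + β) := by
  set c' := (c + 1) * R ^ β
  have hRβ : 0 < R ^ β := Real.rpow_pos_of_pos hR _
  have hc' : 0 < c' := by positivity
  refine ⟨V * (2 * (c + 1)) * d * (1 + c') ^ (d - 1), by positivity, fun q hq => ?_⟩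
  -- Beyond `R` the annulus is null; below `R`, the factor `q^β` is bounded by `R^β`.
  rcases lt_or_ge R q with hqR | hqR
  · have h0 : ν.real {x | q ≤ a x ∧ a x ≤ q + c * q ^ (β + 1)} = 0 := by
      rw [measureReal_eq_zero_iff]
      refine measure_mono_null (fun x hx => ?_) haR
      intro h
      exact absurd (hqR.trans_le hx.1) (not_lt.2 h)
    rw [h0]
    positivity
  -- enlarging the coefficient makes the inner radius strictly smaller than `q`
  set w := (c + 1) * q ^ (β + 1) with hwdef
  have hqβ : 0 < q ^ (β + 1) := Real.rpow_pos_of_pos hq _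
  have hw : 0 < w := by positivity
  have hcw : c * q ^ (β + 1) ≤ w := by rw [hwdef]; nlinarith
  have hwq : w ≤ c' * q := by
    rw [hwdef, Real.rpow_add hq, Real.rpow_one, ← mul_assoc]
    have := Real.rpow_le_rpow hq.le hqR hβ.le
    simp only [c']
    gcongr
  set s := max 0 (q - w)
  have hs0 : 0 ≤ s := le_max_left _ _
  have hsq : s < q := max_lt hq (by linarith)
  have hsw : q - w ≤ s := le_max_right _ _
  calc _ ≤ ν.real {x | s < a x ∧ a x ≤ q + w} :=
        measureReal_mono fun x hx => ⟨hsq.trans_le hx.1, hx.2.trans (by linarith)⟩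
    _ ≤ V * ((q + w) ^ d - s ^ d) := hann _ _ hs0 (by linarith)
    _ ≤ V * (2 * w * d * ((1 + c') * q) ^ (d - 1)) := by
        gcongr
        -- A difference of `d`-th powers is at most the difference times `d` times the larger base
        -- to the power `d - 1`; the enlarged annulus has width at most `2w` and outer radius at
        -- most `(1 + c') q`.
        refine (le_abs_self _).trans ((abs_pow_sub_pow_le _ _ _).trans ?_)
        rw [abs_of_nonneg (by linarith : 0 ≤ q + w - s), abs_of_nonneg (by linarith : 0 ≤ q + w),
          abs_of_nonneg hs0, max_eq_left (by linarith : s ≤ q + w)]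
        gcongr <;> linarith
    _ = _ := by
        obtain ⟨k, rfl⟩ : ∃ k, d = k + 1 := ⟨d - 1, by omega⟩
        have : q ^ (((k + 1 : ℕ) : ℝ) + β) = q ^ (β + 1) * q ^ k := by
          rw [← Real.rpow_natCast q k, ← Real.rpow_add hq]; congr 1; push_cast; ring
        rw [this, mul_pow, hwdef, Nat.add_sub_cancel]
        ring

/-! ### The objective against its quadratic part -/

/-- Comparison of an objective function with the quadratic form in its expansion. -/
theorem IsObjective.exists_comparison {r : ℝ} {f : EuclideanSpace ℝ (Fin d) → ℝ}
    {xs : EuclideanSpace ℝ (Fin d)} {H : Matrix (Fin d) (Fin d) ℝ} {α : ℝ}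
    (hf : IsObjective r f xs H α)
    {L : EuclideanSpace ℝ (Fin d) ≃L[ℝ] EuclideanSpace ℝ (Fin d)}
    (hL : ∀ z, sqNormH H z = ‖L z‖ ^ 2) {R : ℝ} (hR : 0 < R)
    (hLR : ∀ x ∈ Metric.closedBall 0 r, ‖L (x - xs)‖ ≤ R) :
    ∃ c₀ > 0, ∃ c₁ > 0, ∃ c > 0,
      (∀ x ∈ Metric.closedBall 0 r, c₀ * ‖L (x - xs)‖ ^ 2 ≤ f x) ∧
      (∀ x ∈ Metric.closedBall 0 r, f x ≤ c₁ * ‖L (x - xs)‖ ^ 2) ∧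
      (∀ x ∈ Metric.closedBall 0 r, ∀ y ∈ Metric.closedBall 0 r, f x ≤ f y →
        ‖L (x - xs)‖ ≤ ‖L (y - xs)‖ + c * ‖L (y - xs)‖ ^ (α - 1)) := by
  obtain ⟨ε, ⟨M, hM, hε⟩, hexp⟩ := hf.expansion
  have hα := hf.two_lt
  set a : EuclideanSpace ℝ (Fin d) → ℝ := fun x => ‖L (x - xs)‖ with ha
  have ha0 : ∀ x, 0 ≤ a x := fun x => norm_nonneg _
  have hdev : ∀ x ∈ Metric.closedBall 0 r, |f x - a x ^ 2| ≤ M * a x ^ α := by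
    intro x hx
    rw [hexp x hx, hL, add_sub_cancel_left, ← Real.rpow_natCast, ← Real.rpow_mul (norm_nonneg _),
      abs_mul, abs_of_nonneg (by positivity), mul_comm]
    push_cast
    rw [mul_div_cancel₀ _ (two_ne_zero)]
    gcongr
    exact hε _
  have hsplit : ∀ x, a x ^ α = a x ^ (α - 2) * a x ^ 2 := by
    intro x
    rw [← Real.rpow_natCast, ← Real.rpow_add_of_nonneg (ha0 x) (by linarith) (by positivity)]
    congr 1; push_cast; ring
  have hxs : xs ∈ Metric.closedBall 0 r := mem_closedBall_zero_iff.2 hf.norm_lt.le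
  have hfxs : f xs = 0 := by
    have h0 : a xs = 0 := by simp [ha]
    have := hdev xs hxs
    rw [hsplit, h0] at this
    simpa using this
  have hac : Continuous a := by fun_prop
  obtain ⟨c₀, hc₀, hlow⟩ : ∃ c₀ > 0, ∀ x ∈ Metric.closedBall 0 r, c₀ * a x ^ 2 ≤ f x := by
    -- For `a ≤ δ` the error term is at most half of the quadratic one; on the rest of the ball, `f`
    -- has a positive minimum by compactness.
    set δ := (1 / (2 * M)) ^ (1 / (α - 2))
    have hδ : 0 < δ := by positivity
    have hδM : M * δ ^ (α - 2) = 1 / 2 := by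
      rw [← Real.rpow_mul (by positivity), one_div_mul_cancel (by linarith), Real.rpow_one]
      field_simp
    have hnear : ∀ x ∈ Metric.closedBall 0 r, a x ≤ δ → 1 / 2 * a x ^ 2 ≤ f x := by
      intro x hx hxδ
      have h1 := (abs_le.1 (hdev x hx)).1
      rw [hsplit] at h1
      have h2 : M * a x ^ (α - 2) ≤ 1 / 2 := by
        rw [← hδM]
        gcongr
      nlinarith [sq_nonneg (a x)]
    have hK : IsCompact (Metric.closedBall (0 : EuclideanSpace ℝ (Fin d)) r ∩ {x | δ ≤ a x}) :=
      (isCompact_closedBall _ _).inter_right (isClosed_le continuous_const hac)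
    rcases Set.eq_empty_or_nonempty
      (Metric.closedBall (0 : EuclideanSpace ℝ (Fin d)) r ∩ {x | δ ≤ a x}) with hem | hne
    · refine ⟨1 / 2, by norm_num, fun x hx => hnear x hx ?_⟩
      by_contra! h
      exact Set.notMem_empty x (hem ▸ ⟨hx, h.le⟩)
    · obtain ⟨z, ⟨hzb, hzδ⟩, hz⟩ := hK.exists_isMinOn hne (hf.continuousOn.mono Set.inter_subset_left)
      have hfz : 0 < f z := by
        rw [← hfxs]
        refine hf.unique_min z hzb fun h => ?_
        have : δ ≤ a xs := h ▸ hzδ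
        simp [ha] at this
        linarith
      refine ⟨min (1 / 2) (f z / R ^ 2), by positivity, fun x hx => ?_⟩
      rcases le_total (a x) δ with h | h
      · refine le_trans ?_ (hnear x hx h)
        gcongr
        exact min_le_left _ _
      · calc min (1 / 2) (f z / R ^ 2) * a x ^ 2 ≤ f z / R ^ 2 * R ^ 2 := by
              gcongr
              · exact min_le_right _ _
              · exact hLR x hx
          _ = f z := div_mul_cancel₀ _ (by positivity)
          _ ≤ f x := hz ⟨hx, h⟩
  have hup : ∀ x ∈ Metric.closedBall 0 r, f x ≤ (1 + M * R ^ (α - 2)) * a x ^ 2 := by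
    intro x hx
    have h1 := (abs_le.1 (hdev x hx)).2
    rw [hsplit] at h1
    have h2 : M * a x ^ (α - 2) ≤ M * R ^ (α - 2) := by
      gcongr
      · exact hLR x hx
    nlinarith [sq_nonneg (a x)]
  set c₁ := 1 + M * R ^ (α - 2)
  have hc₁ : 0 < c₁ := by positivity
  set K := √(c₁ / c₀)
  refine ⟨c₀, hc₀, c₁, hc₁, M * (1 + K ^ α), by positivity, hlow, hup, fun x hx y hy hxy => ?_⟩
  -- This crude comparison turns the error term at `x` into one at `y`.
  have h1 : a x ≤ K * a y := by
    refine abs_le_of_sq_le_sq' ?_ (by have := ha0 y; positivity) |>.2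
    rw [mul_pow, Real.sq_sqrt (by positivity), div_mul_eq_mul_div, le_div_iff₀ hc₀, mul_comm]
    exact (hlow x hx).trans (hxy.trans (hup y hy))
  have h2 : a x ^ α ≤ K ^ α * a y ^ α := by
    rw [← Real.mul_rpow (by positivity) (ha0 y)]
    exact Real.rpow_le_rpow (ha0 x) h1 (by linarith)
  have h3 : a y ^ α = a y * a y ^ (α - 1) := by
    nth_rewrite 2 [← Real.rpow_one (a y)]
    rw [← Real.rpow_add_of_nonneg (ha0 y) (by norm_num) (by linarith)]
    congr 1; ring
  have h4 : 0 ≤ a y ^ (α - 1) := Real.rpow_nonneg (ha0 y) _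
  have h5 : 0 ≤ K ^ α := by positivity
  refine abs_le_of_sq_le_sq' ?_ (by have := ha0 y; positivity) |>.2
  have h6 := (abs_le.1 (hdev x hx)).1
  have h7 := (abs_le.1 (hdev y hy)).2
  calc a x ^ 2 ≤ a y ^ 2 + M * a y ^ α + M * (K ^ α * a y ^ α) := by nlinarith
    _ = a y ^ 2 + (M * (1 + K ^ α)) * (a y * a y ^ (α - 1)) := by rw [h3]; ring
    -- Completing the square: `b² + Cbe ≤ (b + Ce)²` for nonnegative `b`, `C`, `e`.
    _ ≤ (a y + M * (1 + K ^ α) * a y ^ (α - 1)) ^ 2 := by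
        have : 0 ≤ (M * (1 + K ^ α)) * (a y * a y ^ (α - 1)) := by
          have := ha0 y; positivity
        nlinarith [sq_nonneg (M * (1 + K ^ α) * a y ^ (α - 1))]

end MuBest

namespace MuBest

open MeasureTheory Finset

/-! ### The set of the `m` smallest entries -/

section BestSet

variable {n m : ℕ}

/-- The indices of the `m` smallest entries of `a`, ties being broken by the index. -/
noncomputable def bestSet (m : ℕ) (a : Fin n → ℝ) : Finset (Fin n) :=
  univ.filter fun i => ((Tuple.sort a).symm i : ℕ) < m

theorem card_filter_perm_lt (σ : Equiv.Perm (Fin n)) (hm : m ≤ n) :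
    #{i | (σ.symm i : ℕ) < m} = m := by
  have : #{i | (σ.symm i : ℕ) < m} = #{i : Fin n | (i : ℕ) < m} :=
    card_equiv σ.symm fun i => by simp
  rw [this, Fin.card_filter_val_lt]
  exact min_eq_right hm

theorem le_of_mem_bestSet {a : Fin n → ℝ} {i j : Fin n} (hi : i ∈ bestSet m a)
    (hj : j ∉ bestSet m a) : a i ≤ a j := by
  simp only [bestSet, mem_filter, mem_univ, true_and] at hi hj
  have := Tuple.monotone_sort a (a := (Tuple.sort a).symm i) (b := (Tuple.sort a).symm j)
    (Fin.le_def.2 (by omega))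
  simpa using this

/-- The sorting permutation has finitely many possible values, and `Tuple.eq_sort_iff` describes
each of them by finitely many comparisons of entries. -/
theorem measurableSet_mem_bestSet {Ω : Type*} [MeasurableSpace Ω] {g : Ω → Fin n → ℝ}
    (hg : ∀ j, Measurable fun ω => g ω j) (i : Fin n) :
    MeasurableSet {ω | i ∈ bestSet m (g ω)} := by
  have h : {ω | i ∈ bestSet m (g ω)} = ⋃ τ : Equiv.Perm (Fin n), ⋃ _ : (τ.symm i : ℕ) < m,
      {ω | Monotone (g ω ∘ τ) ∧ ∀ k l : Fin n, k < l → g ω (τ k) = g ω (τ l) → τ k < τ l} := by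
    ext ω
    simp only [bestSet, mem_filter, mem_univ, true_and, Set.mem_ofPred_eq, Set.mem_iUnion,
      exists_prop, ← Tuple.eq_sort_iff]
    constructor
    · intro h; exact ⟨_, h, rfl⟩
    · rintro ⟨τ, h, rfl⟩; exact h
  rw [h]
  refine MeasurableSet.iUnion fun τ => MeasurableSet.iUnion fun _ => ?_
  refine MeasurableSet.inter ?_ ?_
  · simp only [Function.comp]
    refine measurableSet_setOfPred.2 <| Measurable.forall fun k => Measurable.forall fun l => ?_
    refine Measurable.imp measurable_const ?_
    exact measurableSet_setOfPred.1 (measurableSet_le (hg _) (hg _))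
  · refine measurableSet_setOfPred.2 <| Measurable.forall fun k => Measurable.forall fun l => ?_
    refine Measurable.imp measurable_const (Measurable.imp ?_ measurable_const)
    exact measurableSet_setOfPred.1 (measurableSet_eq_fun (hg _) (hg _))

theorem measurable_sum_mem {Ω F : Type*} [MeasurableSpace Ω] [AddCommMonoid F] [MeasurableSpace F]
    [MeasurableAdd₂ F] {T : Ω → Finset (Fin n)} {W : Fin n → Ω → F} (hW : ∀ i, Measurable (W i))
    (hT : ∀ i, MeasurableSet {x | i ∈ T x}) : Measurable fun x => ∑ i ∈ T x, W i x := by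
  have : (fun x => ∑ i ∈ T x, W i x) = fun x => ∑ i, {x | i ∈ T x}.indicator (W i) x := by
    funext x
    simp only [Set.indicator_apply, Set.mem_ofPred_eq]
    rw [← Finset.sum_filter]
    congr 1
    ext i; simp
  rw [this]
  exact Finset.measurable_sum _ fun i _ => (hW i).indicator (hT i)

end BestSet

/-! ### Symmetry under reflection -/

/-- Orthogonality of the summands of a selection by an even criterion of odd random vectors. -/
theorem integral_norm_sq_sum_eq_of_reflection {E F : Type*} [MeasurableSpace E]
    [NormedAddCommGroup F] [InnerProductSpace ℝ F] [MeasurableSpace F] [BorelSpace F]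
    [SecondCountableTopology F]
    {ν : Measure E} [IsProbabilityMeasure ν] {φ : E → E} (hφ : MeasurePreserving φ ν ν)
    {a : E → ℝ} (haφ : ∀ y, a (φ y) = a y) {Z : E → F} (hZ : Measurable Z)
    (hZφ : ∀ y, Z (φ y) = -Z y) {B : ℝ} (hZB : ∀ y, ‖Z y‖ ≤ B) {n : ℕ}
    {T : (Fin n → ℝ) → Finset (Fin n)}
    (hT : ∀ i, MeasurableSet {x : Fin n → E | i ∈ T fun j => a (x j)}) :
    ∫ x, ‖∑ i ∈ T fun j => a (x j), Z (x i)‖ ^ 2 ∂(Measure.pi fun _ : Fin n => ν) =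
      ∫ x, ∑ i ∈ T fun j => a (x j), ‖Z (x i)‖ ^ 2 ∂(Measure.pi fun _ : Fin n => ν) := by
  set π := Measure.pi fun _ : Fin n => ν
  let W : Fin n → (Fin n → E) → F := fun i =>
    {x : Fin n → E | i ∈ T fun j => a (x j)}.indicator fun x => Z (x i)
  have hWm : ∀ i, Measurable (W i) := fun i =>
    (hZ.comp (measurable_pi_apply i)).indicator (hT i)
  have hWB : ∀ i x, ‖W i x‖ ≤ B := by
    intro i x
    exact (norm_indicator_le_norm_self _ _).trans (hZB _)
  have hsum : ∀ x, ∑ i ∈ T fun j => a (x j), Z (x i) = ∑ i, W i x := by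
    intro x
    simp only [W, Set.indicator_apply, Set.mem_ofPred_eq]
    rw [← Finset.sum_filter]
    congr 1
    ext i; simp
  have hsq : ∀ x, ∑ i ∈ T fun j => a (x j), ‖Z (x i)‖ ^ 2 = ∑ i, inner ℝ (W i x) (W i x) := by
    intro x
    simp only [real_inner_self_eq_norm_sq, W, Set.indicator_apply, Set.mem_ofPred_eq,
      apply_ite (fun v : F => ‖v‖ ^ 2), norm_zero, ne_eq, OfNat.ofNat_ne_zero, not_false_eq_true,
      zero_pow]
    rw [← Finset.sum_filter]
    congr 1
    ext i; simp
  have hint : ∀ i j, Integrable (fun x => inner ℝ (W i x) (W j x)) π := by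
    intro i j
    have hB : ∀ x : Fin n → E, 0 ≤ B := fun x => (norm_nonneg _).trans (hWB i x)
    refine Integrable.of_bound ((hWm i).inner (hWm j)).aestronglyMeasurable (B * B)
      (ae_of_all _ fun x => ?_)
    exact (norm_inner_le_norm _ _).trans
      (mul_le_mul (hWB i x) (hWB j x) (norm_nonneg _) (hB x))
  have hzero : ∀ i j, i ≠ j → ∫ x, inner ℝ (W i x) (W j x) ∂π = 0 := by
    intro i j hij
    -- Applying `φ` to the point `i` alone preserves the law and the selection, changes the sign of
    -- `W i` and fixes `W j`; so the cross term equals its own negative.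
    let Φ : (Fin n → E) → Fin n → E := fun x k => (if k = i then φ else id) (x k)
    have hΦ : MeasurePreserving Φ π π := by
      refine measurePreserving_pi (fun _ => ν) (fun _ => ν) fun k => ?_
      by_cases hk : k = i
      · simpa [hk] using hφ
      · simpa [hk] using MeasurePreserving.id ν
    have haΦ : ∀ x k, a (Φ x k) = a (x k) := by
      intro x k
      by_cases hk : k = i <;> simp [Φ, hk, haφ]
    have hi : ∀ x, W i (Φ x) = -W i x := by
      intro x
      simp only [W, Set.indicator_apply, Set.mem_ofPred_eq, haΦ]
      split_ifs <;> simp [Φ, hZφ]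
    have hj : ∀ x, W j (Φ x) = W j x := by
      intro x
      simp only [W, Set.indicator_apply, Set.mem_ofPred_eq, haΦ]
      simp [Φ, hij.symm]
    have h1 : ∫ x, inner ℝ (W i x) (W j x) ∂π = ∫ x, inner ℝ (W i (Φ x)) (W j (Φ x)) ∂π := by
      have hm := ((hWm i).inner (𝕜 := ℝ) (hWm j)).aestronglyMeasurable (μ := π.map Φ)
      rw [← integral_map hΦ.measurable.aemeasurable hm, hΦ.map_eq]
    simp only [hi, hj, inner_neg_left, integral_neg] at h1
    linarith
  simp only [hsum, hsq, ← real_inner_self_eq_norm_sq (∑ i, W i _), sum_inner, inner_sum]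
  rw [integral_finsetSum _ fun i _ => integrable_finsetSum _ fun j _ => hint _ _,
    integral_finsetSum _ fun i _ => hint _ _]
  refine Finset.sum_congr rfl fun i _ => ?_
  rw [integral_finsetSum _ fun j _ => hint _ _]
  exact Finset.sum_eq_single i (fun j _ hj => hzero _ _ hj) (by simp)

/-- The point reflection at `xs` inside the ellipsoid `‖L (x - xs)‖ ≤ ρ`. -/
noncomputable def ellipsoidReflection {d : ℕ}
    (L : EuclideanSpace ℝ (Fin d) ≃L[ℝ] EuclideanSpace ℝ (Fin d))
    (xs : EuclideanSpace ℝ (Fin d)) (ρ : ℝ) (x : EuclideanSpace ℝ (Fin d)) :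
    EuclideanSpace ℝ (Fin d) :=
  {x | ‖L (x - xs)‖ ≤ ρ}.piecewise (fun x => xs + xs - x) id x

section Reflection

variable {d : ℕ} {L : EuclideanSpace ℝ (Fin d) ≃L[ℝ] EuclideanSpace ℝ (Fin d)}
  {xs : EuclideanSpace ℝ (Fin d)} {ρ : ℝ}

theorem norm_map_ellipsoidReflection (x : EuclideanSpace ℝ (Fin d)) :
    ‖L (ellipsoidReflection L xs ρ x - xs)‖ = ‖L (x - xs)‖ := by
  unfold ellipsoidReflection Set.piecewise
  split_ifs
  · rw [show xs + xs - x - xs = -(x - xs) by abel, map_neg, norm_neg]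
  · rfl

/-- Point reflection preserves volume and the ellipsoid, and the ellipsoid lies in the ball, so the
ball is preserved as well. -/
theorem measurePreserving_ellipsoidReflection {r : ℝ}
    (hρ : ∀ x, ‖L (x - xs)‖ ≤ ρ → x ∈ Metric.closedBall 0 r) :
    MeasurePreserving (ellipsoidReflection L xs ρ) (uniformBall d r) (uniformBall d r) := by
  set S := {x | ‖L (x - xs)‖ ≤ ρ}
  have hS : MeasurableSet S := measurableSet_le (by fun_prop) measurable_const
  have hmeas : Measurable (ellipsoidReflection L xs ρ) :=
    Measurable.piecewise hS (by fun_prop) measurable_id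
  have hin : ∀ {x}, x ∈ S → ellipsoidReflection L xs ρ x = xs + xs - x :=
    S.piecewise_eq_of_mem _ _
  have hout : ∀ {x}, x ∉ S → ellipsoidReflection L xs ρ x = x :=
    S.piecewise_eq_of_notMem _ _
  have hinS : ∀ x, ellipsoidReflection L xs ρ x ∈ S ↔ x ∈ S := fun x => by
    simp only [S, Set.mem_ofPred_eq, norm_map_ellipsoidReflection]
  have hvol : MeasurePreserving (ellipsoidReflection L xs ρ) volume volume := by
    refine ⟨hmeas, Measure.ext fun s hs => ?_⟩
    rw [Measure.map_apply hmeas hs, ← measure_inter_add_sdiff (_ ⁻¹' s) hS,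
      ← measure_inter_add_sdiff s hS]
    congr 1
    · have h1 : ellipsoidReflection L xs ρ ⁻¹' s ∩ S = (fun x => xs + xs - x) ⁻¹' (s ∩ S) := by
        ext x
        have h2 : xs + xs - x ∈ S ↔ x ∈ S := by
          simp only [S, Set.mem_ofPred_eq]
          rw [show xs + xs - x - xs = -(x - xs) by abel, map_neg, norm_neg]
        by_cases hx : x ∈ S
        · simp only [Set.mem_inter_iff, Set.mem_preimage, hin hx, h2]
        · simp only [Set.mem_inter_iff, Set.mem_preimage, h2, hx, and_false]
      rw [h1]
      exact (Measure.measurePreserving_sub_left volume (xs + xs)).measure_preimage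
        (hs.inter hS).nullMeasurableSet
    · congr 1
      ext x
      by_cases hx : x ∈ S
      · simp only [Set.mem_sdiff, hx, not_true_eq_false, and_false]
      · simp only [Set.mem_sdiff, Set.mem_preimage, hout hx]
  have hball : ellipsoidReflection L xs ρ ⁻¹' Metric.closedBall 0 r = Metric.closedBall 0 r := by
    ext x
    by_cases hx : x ∈ S
    · exact iff_of_true (hρ _ ((hinS x).2 hx)) (hρ _ hx)
    · rw [Set.mem_preimage, hout hx]
  have h := (hvol.restrict_preimage (s := Metric.closedBall 0 r) measurableSet_closedBall)
  rw [hball] at h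
  exact h.smul_measure _

end Reflection

end MuBest

namespace MuBest

open MeasureTheory Finset

/-! ### Comparing the two selections, sample by sample -/

section Deterministic

variable {n m : ℕ} {F : Type*} [NormedAddCommGroup F]

/-- Whether `b` lies in the annulus `[q, q + c q^{β+1}]`. -/
def InAnnulus (c β q b : ℝ) : Prop := q ≤ b ∧ b ≤ q + c * q ^ (β + 1)

/-- The lower bound holds as `i` is not among the `m` smallest. For the upper one, the two
selections have equal size, so some `j` was dropped in favour of `i`: then `φ i ≤ φ j` while `a j ≤
q`. -/
theorem inAnnulus_of_mem_sdiff {S : Finset (Fin n)} {a φ : Fin n → ℝ} {c β : ℝ} (hc : 0 ≤ c)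
    (hβ : 0 ≤ β) (ha : ∀ i, 0 ≤ a i) (hm : m ≤ n) (hS : #S = m)
    (hSφ : ∀ i ∈ S, ∀ j, j ∉ S → φ i ≤ φ j)
    (hφ : ∀ i j, φ i ≤ φ j → a i ≤ a j + c * a j ^ (β + 1)) {i : Fin n}
    (hi : i ∈ S \ bestSet m a) : InAnnulus c β (ordStat univ m a) (a i) := by
  have hT : #(bestSet m a) = m := card_filter_perm_lt _ hm
  obtain ⟨hiS, hiT⟩ := mem_sdiff.1 hi
  have hlow : ∀ i ∈ bestSet m a, ∀ j ∈ univ, j ∉ bestSet m a → a i ≤ a j :=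
    fun i hi j _ hj => le_of_mem_bestSet hi hj
  refine ⟨ordStat_le_of_lower (subset_univ _) hT hlow (mem_univ i) hiT (ha i), ?_⟩
  obtain ⟨j, hj⟩ : (bestSet m a \ S).Nonempty := by
    rw [← card_pos, card_sdiff_comm (hT.trans hS.symm)]
    exact card_pos.2 ⟨i, hi⟩
  obtain ⟨hjT, hjS⟩ := mem_sdiff.1 hj
  have hjq : a j ≤ ordStat univ m a := le_ordStat_of_lower (subset_univ _) hT hlow hjT
  refine (hφ i j (hSφ i hiS j hjS)).trans ?_
  gcongr
  exact ha j

theorem norm_sum_le_of_selection {S : Finset (Fin n)} {Y : Fin n → F} {φ : Fin n → ℝ}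
    {c β R ρ : ℝ} (hc : 0 ≤ c) (hβ : 0 < β) (hρ : 0 < ρ) (hR : 0 ≤ R) (hYR : ∀ i, ‖Y i‖ ≤ R)
    (hm : m ≤ n) (hS : #S = m)
    (hSφ : ∀ i ∈ S, ∀ j, j ∉ S → φ i ≤ φ j)
    (hφ : ∀ i j, φ i ≤ φ j → ‖Y i‖ ≤ ‖Y j‖ + c * ‖Y j‖ ^ (β + 1)) :
    ‖∑ i ∈ S, Y i‖ ≤
      ‖∑ i ∈ bestSet m fun j => ‖Y j‖, if ‖Y i‖ ≤ ρ then Y i else 0‖ +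
      m * (ordStat univ m fun j => ‖Y j‖) * ((ordStat univ m fun j => ‖Y j‖) / ρ) ^ β +
      2 * (1 + c * R ^ β) *
        (#(S \ bestSet m fun j => ‖Y j‖) * ordStat univ m fun j => ‖Y j‖) := by
  set a : Fin n → ℝ := fun j => ‖Y j‖ with ha_def
  have ha : ∀ i, 0 ≤ a i := fun i => norm_nonneg _
  set T := bestSet m a with hT_def
  set q := ordStat univ m a
  have hq0 : 0 ≤ q := ordStat_nonneg
  have hqR : q ≤ R := ordStat_le hR fun j _ => hYR j
  have hT : #T = m := card_filter_perm_lt _ hm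
  have hTq : ∀ i ∈ T, a i ≤ q := fun i hi =>
    le_ordStat_of_lower (subset_univ _) hT (fun i hi j _ hj => le_of_mem_bestSet hi hj) hi
  have hwq : q + c * q ^ (β + 1) ≤ (1 + c * R ^ β) * q := by
    rw [Real.rpow_add_one' hq0 (by linarith)]
    have := Real.rpow_le_rpow hq0 hqR hβ.le
    have : c * (q ^ β * q) ≤ c * (R ^ β * q) := by gcongr
    linarith
  have hq1 : q ≤ (1 + c * R ^ β) * q := by
    have : 0 ≤ c * R ^ β := by positivity
    nlinarith
  have h1 : ∑ i ∈ S, Y i = ∑ i ∈ T, (if a i ≤ ρ then Y i else 0) +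
      ∑ i ∈ T, (Y i - if a i ≤ ρ then Y i else 0) + (∑ i ∈ S \ T, Y i - ∑ i ∈ T \ S, Y i) := by
    rw [← sum_add_distrib, sum_sdiff_sub_sum_sdiff]
    simp
  have h2 : ‖∑ i ∈ T, (Y i - if a i ≤ ρ then Y i else 0)‖ ≤ m * q * (q / ρ) ^ β := by
    refine (norm_sum_le _ _).trans ((sum_le_card_nsmul T _ (q * (q / ρ) ^ β) ?_).trans ?_)
    · intro i hi
      split_ifs with h
      · simp; positivity
      · rw [sub_zero]
        -- A term is cut off only if `ρ < a i ≤ q`, hence the factor `(q / ρ) ^ β` is at least one.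
        refine (hTq i hi).trans (le_mul_of_one_le_right hq0 ?_)
        refine Real.one_le_rpow ?_ hβ.le
        rw [one_le_div hρ]
        exact (not_le.1 h).le.trans (hTq i hi)
    · rw [hT, nsmul_eq_mul, mul_assoc]
  have h3 : ‖∑ i ∈ S \ T, Y i‖ ≤ #(S \ T) * ((1 + c * R ^ β) * q) := by
    refine (norm_sum_le _ _).trans ((sum_le_card_nsmul _ _ _ fun i hi => ?_).trans_eq
      (nsmul_eq_mul _ _))
    exact (inAnnulus_of_mem_sdiff hc hβ.le ha hm hS hSφ hφ hi).2.trans hwq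
  have h4 : ‖∑ i ∈ T \ S, Y i‖ ≤ #(S \ T) * ((1 + c * R ^ β) * q) := by
    rw [card_sdiff_comm (hS.trans hT.symm)]
    refine (norm_sum_le _ _).trans ((sum_le_card_nsmul _ _ _ fun i hi => ?_).trans_eq
      (nsmul_eq_mul _ _))
    exact (hTq i (mem_sdiff.1 hi).1).trans hq1
  rw [h1]
  refine (norm_add_le _ _).trans (add_le_add ((norm_add_le _ _).trans (add_le_add le_rfl h2)) ?_)
  refine (norm_sub_le _ _).trans ((add_le_add h3 h4).trans_eq ?_)
  ring

open Classical in
/-- The indicator that the entry `a i` lies in the annulus at the `m`-th smallest entry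
of `A`. -/
noncomputable def annulusInd (c β : ℝ) (m : ℕ) (A : Finset (Fin n)) (i : Fin n)
    (a : Fin n → ℝ) : ENNReal :=
  if InAnnulus c β (ordStat A m a) (a i) then 1 else 0

/-- The square of the count is a sum over diagonal and off-diagonal pairs in `S \ T`. Such indices
lie outside `T`, so they can be deleted from the order statistic, and the bound no longer refers to
`S`. -/
theorem ofReal_card_sdiff_mul_sq_le {S : Finset (Fin n)} {a φ : Fin n → ℝ} {c β : ℝ}
    (hc : 0 ≤ c) (hβ : 0 ≤ β) (ha : ∀ i, 0 ≤ a i) (hm : m ≤ n) (hS : #S = m)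
    (hSφ : ∀ i ∈ S, ∀ j, j ∉ S → φ i ≤ φ j)
    (hφ : ∀ i j, φ i ≤ φ j → a i ≤ a j + c * a j ^ (β + 1)) :
    ENNReal.ofReal ((#(S \ bestSet m a) * ordStat univ m a) ^ 2) ≤
      ∑ i, (annulusInd c β m (univ.erase i) i a *
          ENNReal.ofReal (ordStat (univ.erase i) m a ^ 2) +
        ∑ k ∈ univ.erase i, annulusInd c β m ((univ.erase i).erase k) i a *
          (ENNReal.ofReal (ordStat ((univ.erase i).erase k) m a ^ 2) *
          annulusInd c β m ((univ.erase i).erase k) k a)) := by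
  have hT : #(bestSet m a) = m := card_filter_perm_lt _ hm
  have hord : ∀ A, bestSet m a ⊆ A → ordStat A m a = ordStat univ m a := by
    intro A hA
    rw [ordStat_eq_of_lower hA hT fun i hi j _ hj => le_of_mem_bestSet hi hj,
      ordStat_eq_of_lower (subset_univ _) hT fun i hi j _ hj => le_of_mem_bestSet hi hj]
  set q := ordStat univ m a
  set D := S \ bestSet m a
  have hann : ∀ A i, bestSet m a ⊆ A → i ∈ D → annulusInd c β m A i a = 1 := by
    intro A i hA hi
    rw [annulusInd, hord A hA, if_pos (inAnnulus_of_mem_sdiff hc hβ ha hm hS hSφ hφ hi)]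
  have hsub : ∀ i ∈ D, bestSet m a ⊆ univ.erase i := fun i hi =>
    subset_erase.2 ⟨subset_univ _, (mem_sdiff.1 hi).2⟩
  have hsub2 : ∀ i ∈ D, ∀ k ∈ D, bestSet m a ⊆ (univ.erase i).erase k := fun i hi k hk =>
    subset_erase.2 ⟨hsub i hi, (mem_sdiff.1 hk).2⟩
  calc ENNReal.ofReal ((#D * q) ^ 2) = ∑ i ∈ D, ∑ k ∈ D, ENNReal.ofReal (q ^ 2) := by
        simp only [sum_const, nsmul_eq_mul]
        rw [mul_pow, ENNReal.ofReal_mul (by positivity), sq (#D : ℝ),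
          ENNReal.ofReal_mul (by positivity), ENNReal.ofReal_natCast, mul_assoc]
    _ = ∑ i ∈ D, (ENNReal.ofReal (q ^ 2) + ∑ k ∈ D.erase i, ENNReal.ofReal (q ^ 2)) :=
        sum_congr rfl fun i hi => (add_sum_erase D _ hi).symm
    _ ≤ ∑ i ∈ D, _ := by
        refine sum_le_sum fun i hi => add_le_add ?_ ?_
        · rw [hann _ i (hsub i hi) hi, hord _ (hsub i hi), one_mul]
        · refine (sum_le_sum fun k hk => ?_).trans
            (sum_le_sum_of_subset (erase_subset_erase i (subset_univ D)))
          have hkD := mem_of_mem_erase hk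
          rw [hann _ i (hsub2 i hi k hkD) hi, hann _ k (hsub2 i hi k hkD) hkD,
            hord _ (hsub2 i hi k hkD), one_mul, mul_one]
    _ ≤ _ := sum_le_sum_of_subset (subset_univ D)

end Deterministic

/-! ### Integrating out the deleted points -/

section Expectation

variable {E : Type*} [MeasurableSpace E] {ν : Measure E} [IsProbabilityMeasure ν] {a : E → ℝ}
  {n m : ℕ} {c β : ℝ}

theorem measurable_ordStat_sample (ha : Measurable a) (A : Finset (Fin n)) :
    Measurable fun x : Fin n → E => ordStat A m fun j => a (x j) :=
  measurable_ordStat fun j => ha.comp (measurable_pi_apply j)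

theorem measurable_annulusInd (ha : Measurable a) (A : Finset (Fin n)) (i : Fin n) :
    Measurable fun x : Fin n → E => annulusInd c β m A i fun j => a (x j) := by
  have hq := measurable_ordStat_sample (m := m) ha A
  have hai : Measurable fun x : Fin n → E => a (x i) := ha.comp (measurable_pi_apply i)
  refine Measurable.ite (MeasurableSet.inter (measurableSet_le hq hai) (measurableSet_le hai ?_))
    measurable_const measurable_const
  fun_prop

theorem ordStat_update {E : Type*} {a : E → ℝ} {A : Finset (Fin n)} {i : Fin n} (hi : i ∉ A)
    (x : Fin n → E) (y : E) :
    (ordStat A m fun j => a (Function.update x i y j)) = ordStat A m fun j => a (x j) := by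
  refine ordStat_congr fun j hj => ?_
  rw [Function.update_of_ne]
  rintro rfl
  exact hi hj

/-- Averaging over the position of the point `i`, on which the remaining factors do not depend. -/
theorem lintegral_annulusInd_mul_le (ha : Measurable a) {K γ : ℝ}
    (hann : ∀ q, 0 < q → ν.real {y | q ≤ a y ∧ a y ≤ q + c * q ^ (β + 1)} ≤ K * q ^ γ)
    {A : Finset (Fin n)} {i : Fin n} (hi : i ∉ A) {G : (Fin n → E) → ENNReal} (hG : Measurable G)
    (hGi : ∀ x y, G (Function.update x i y) = G x) :
    ∫⁻ x, annulusInd c β m A i (fun j => a (x j)) *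
        (ENNReal.ofReal ((ordStat A m fun j => a (x j)) ^ 2) * G x)
        ∂(Measure.pi fun _ : Fin n => ν) ≤
      ∫⁻ x, ENNReal.ofReal (K * (ordStat A m fun j => a (x j)) ^ γ) *
        (ENNReal.ofReal ((ordStat A m fun j => a (x j)) ^ 2) * G x)
        ∂(Measure.pi fun _ : Fin n => ν) := by
  have hq := measurable_ordStat_sample (m := m) ha A
  refine lintegral_pi_le_of_update ?_ ?_ i ?_ fun x => ?_
  · exact (measurable_annulusInd ha A i).mul ((hq.pow_const 2).ennreal_ofReal.mul hG)
  · exact (((hq.pow_const γ).const_mul K).ennreal_ofReal).mul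
      ((hq.pow_const 2).ennreal_ofReal.mul hG)
  · intro x y
    rw [ordStat_update hi, hGi]
  · set q := ordStat A m fun j => a (x j) with hq_def
    have hms : MeasurableSet {y | q ≤ a y ∧ a y ≤ q + c * q ^ (β + 1)} :=
      (measurableSet_le measurable_const ha).inter (measurableSet_le ha measurable_const)
    have hind : ∀ y, annulusInd c β m A i (fun j => a (Function.update x i y j)) =
        {y | q ≤ a y ∧ a y ≤ q + c * q ^ (β + 1)}.indicator 1 y := by
      intro y
      simp only [annulusInd, ordStat_update hi, Function.update_self, InAnnulus,
        Set.indicator_apply, Set.mem_ofPred_eq, Pi.one_apply, ← hq_def]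
    simp only [hind, ordStat_update hi, hGi, ← hq_def]
    -- For `q = 0` the annulus bound is not available, but the factor `q ^ 2` vanishes.
    rcases ordStat_nonneg.eq_or_lt (b := q) with h0 | h0
    · simp [← h0]
    · rw [lintegral_mul_const _ (measurable_one.indicator hms), lintegral_indicator_one hms,
        ← ofReal_measureReal]
      gcongr
      exact hann q h0

theorem lintegral_annulusInd_le (ha : Measurable a) {K γ : ℝ} (hK : 0 ≤ K) (hγ : 0 < γ)
    (hann : ∀ q, 0 < q → ν.real {y | q ≤ a y ∧ a y ≤ q + c * q ^ (β + 1)} ≤ K * q ^ γ)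
    {A : Finset (Fin n)} {i : Fin n} (hi : i ∉ A) :
    ∫⁻ x, annulusInd c β m A i (fun j => a (x j)) *
        ENNReal.ofReal ((ordStat A m fun j => a (x j)) ^ 2) ∂(Measure.pi fun _ : Fin n => ν) ≤
      ENNReal.ofReal K * ∫⁻ x, ENNReal.ofReal ((ordStat A m fun j => a (x j)) ^ (γ + 2))
        ∂(Measure.pi fun _ : Fin n => ν) := by
  have h := lintegral_annulusInd_mul_le (m := m) ha hann hi
    (G := fun _ => 1) measurable_const fun _ _ => rfl
  simp only [mul_one] at h
  refine h.trans_eq ?_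
  rw [← lintegral_const_mul' _ _ ENNReal.ofReal_ne_top]
  refine lintegral_congr fun x => ?_
  have hq : 0 ≤ ordStat A m fun j => a (x j) := ordStat_nonneg
  rw [← ENNReal.ofReal_mul (by positivity), ← ENNReal.ofReal_mul hK,
    Real.rpow_add_of_nonneg hq hγ.le (by norm_num), Real.rpow_two, mul_assoc]

/-- Neither point enters the order statistic of `A`, so they are averaged out one after the other,
each contributing `K q ^ γ`. -/
theorem lintegral_annulusInd_mul_annulusInd_le (ha : Measurable a) {K γ : ℝ} (hK : 0 ≤ K)
    (hγ : 0 < γ)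
    (hann : ∀ q, 0 < q → ν.real {y | q ≤ a y ∧ a y ≤ q + c * q ^ (β + 1)} ≤ K * q ^ γ)
    {A : Finset (Fin n)} {i k : Fin n} (hi : i ∉ A) (hk : k ∉ A) (hik : i ≠ k) :
    ∫⁻ x, annulusInd c β m A i (fun j => a (x j)) *
        (ENNReal.ofReal ((ordStat A m fun j => a (x j)) ^ 2) *
          annulusInd c β m A k (fun j => a (x j))) ∂(Measure.pi fun _ : Fin n => ν) ≤
      ENNReal.ofReal (K ^ 2) *
        ∫⁻ x, ENNReal.ofReal ((ordStat A m fun j => a (x j)) ^ (2 * γ + 2))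
        ∂(Measure.pi fun _ : Fin n => ν) := by
  have hq := measurable_ordStat_sample (m := m) ha A
  have h1 := lintegral_annulusInd_mul_le (m := m) ha hann hi
    (measurable_annulusInd (m := m) (c := c) (β := β) ha A k) fun x y => by
      rw [annulusInd, annulusInd, ordStat_update hi, Function.update_of_ne hik.symm]
  have h2 := lintegral_annulusInd_mul_le (m := m) ha hann hk
    (G := fun x => ENNReal.ofReal (K * (ordStat A m fun j => a (x j)) ^ γ))
    ((hq.pow_const γ).const_mul K).ennreal_ofReal fun x y => by
      simp only [ordStat_update hk]
  refine h1.trans (le_trans (le_of_eq ?_) (h2.trans_eq ?_))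
  · exact lintegral_congr fun x => by ring
  · rw [← lintegral_const_mul' _ _ ENNReal.ofReal_ne_top]
    refine lintegral_congr fun x => ?_
    have hq : 0 ≤ ordStat A m fun j => a (x j) := ordStat_nonneg
    rw [← ENNReal.ofReal_mul (by positivity), ← ENNReal.ofReal_mul (by positivity),
      ← ENNReal.ofReal_mul (by positivity),
      Real.rpow_add_of_nonneg hq (by positivity) (by norm_num), Real.rpow_two, two_mul γ,
      Real.rpow_add_of_nonneg hq hγ.le hγ.le]
    congr 1
    ring

end Expectation

end MuBest

namespace MuBest

open MeasureTheory Finset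

/-! ### The second moment of the selected sum -/

/-- The diagonal contributes `n E[q^{d+β+2}]`, the pairs `n² E[q^{2(d+β)+2}]`; the moment bounds and
`n u = m` convert these. The condition `4 ≤ n` gives `n ≤ 2 (n - 2)`, as needed with two points
deleted. -/
theorem exists_lintegral_annulus_sum_le {E : Type*} [MeasurableSpace E] {ν : Measure E}
    [IsProbabilityMeasure ν] {a : E → ℝ} (ha : Measurable a) {d : ℕ} (hd : 1 ≤ d) {c β K : ℝ}
    (hβ : 0 < β) (hK : 0 ≤ K)
    (hann : ∀ q, 0 < q → ν.real {y | q ≤ a y ∧ a y ≤ q + c * q ^ (β + 1)} ≤ K * q ^ (d + β))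
    (hmom : ∀ p : ℝ, 0 < p → ∃ C > 0, ∀ (n m : ℕ) (A : Finset (Fin n)),
      1 ≤ m → 1 ≤ n → n ≤ 2 * #A →
      ∫⁻ x, ENNReal.ofReal ((ordStat A m fun j => a (x j)) ^ p) ∂(Measure.pi fun _ : Fin n => ν) ≤
        ENNReal.ofReal (C * ((m : ℝ) / n) ^ (p / d))) :
    ∃ C > 0, ∀ n m : ℕ, 4 ≤ n → 1 ≤ m → m ≤ n →
      ∫⁻ x, ∑ i, (annulusInd c β m (univ.erase i) i (fun j => a (x j)) *
          ENNReal.ofReal ((ordStat (univ.erase i) m fun j => a (x j)) ^ 2) +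
        ∑ k ∈ univ.erase i, annulusInd c β m ((univ.erase i).erase k) i (fun j => a (x j)) *
          (ENNReal.ofReal ((ordStat ((univ.erase i).erase k) m fun j => a (x j)) ^ 2) *
          annulusInd c β m ((univ.erase i).erase k) k fun j => a (x j)))
        ∂(Measure.pi fun _ : Fin n => ν) ≤
      ENNReal.ofReal (C * (m ^ 2 * ((m : ℝ) / n) ^ (2 * (β + 1) / d) +
        m * ((m : ℝ) / n) ^ ((2 : ℝ) / d))) := by
  have hd' : (0 : ℝ) < d := by exact_mod_cast hd
  obtain ⟨C₁, hC₁, h₁⟩ := hmom (d + β + 2) (by positivity)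
  obtain ⟨C₂, hC₂, h₂⟩ := hmom (2 * (d + β) + 2) (by positivity)
  refine ⟨K * C₁ + K ^ 2 * C₂ + 1, by positivity, fun n m hn hm hmn => ?_⟩
  have hn0 : (0 : ℝ) < n := by positivity
  have hm0 : (0 : ℝ) < m := by positivity
  set u := (m : ℝ) / n with hu
  have hu0 : 0 < u := by positivity
  have hu1 : u ≤ 1 := (div_le_one hn0).2 (by exact_mod_cast hmn)
  have hmu : n * u = m := mul_div_cancel₀ _ hn0.ne'
  have hqm : ∀ A : Finset (Fin n), Measurable fun x : Fin n → E =>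
      ENNReal.ofReal ((ordStat A m fun j => a (x j)) ^ 2) := fun A =>
    ((measurable_ordStat_sample ha A).pow_const 2).ennreal_ofReal
  have hm1 : ∀ (A : Finset (Fin n)) i, Measurable fun x : Fin n → E =>
      annulusInd c β m A i (fun j => a (x j)) *
        ENNReal.ofReal ((ordStat A m fun j => a (x j)) ^ 2) := fun A i =>
    (measurable_annulusInd ha _ _).mul (hqm _)
  have hm2 : ∀ (A : Finset (Fin n)) i k, Measurable fun x : Fin n → E =>
      annulusInd c β m A i (fun j => a (x j)) *
        (ENNReal.ofReal ((ordStat A m fun j => a (x j)) ^ 2) *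
          annulusInd c β m A k fun j => a (x j)) := fun A i k =>
    (measurable_annulusInd ha _ _).mul ((hqm _).mul (measurable_annulusInd ha _ _))
  have hsum : ∀ i : Fin n, ∫⁻ x, (annulusInd c β m (univ.erase i) i (fun j => a (x j)) *
          ENNReal.ofReal ((ordStat (univ.erase i) m fun j => a (x j)) ^ 2) +
        ∑ k ∈ univ.erase i, annulusInd c β m ((univ.erase i).erase k) i (fun j => a (x j)) *
          (ENNReal.ofReal ((ordStat ((univ.erase i).erase k) m fun j => a (x j)) ^ 2) *
          annulusInd c β m ((univ.erase i).erase k) k fun j => a (x j)))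
        ∂(Measure.pi fun _ : Fin n => ν) ≤
      ENNReal.ofReal (K * (C₁ * u ^ ((d + β + 2) / d)) +
        n * (K ^ 2 * (C₂ * u ^ ((2 * (d + β) + 2) / d)))) := by
    intro i
    rw [lintegral_add_left (hm1 _ _), lintegral_finsetSum _ fun k _ => hm2 _ _ _,
      ENNReal.ofReal_add (by positivity) (by positivity)]
    refine add_le_add ?_ ?_
    · refine (lintegral_annulusInd_le ha hK (by positivity) hann (notMem_erase i _)).trans ?_
      rw [ENNReal.ofReal_mul hK]
      gcongr
      refine h₁ n m _ hm (by omega) ?_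
      rw [card_erase_of_mem (mem_univ i), card_fin]
      omega
    · rw [ENNReal.ofReal_mul hn0.le, ENNReal.ofReal_natCast]
      refine (sum_le_card_nsmul _ _ (ENNReal.ofReal
        (K ^ 2 * (C₂ * u ^ ((2 * (d + β) + 2) / d)))) fun k hk => ?_).trans ?_
      · have hki : k ≠ i := ne_of_mem_erase hk
        refine (lintegral_annulusInd_mul_annulusInd_le ha hK (by positivity) hann
          (fun h => notMem_erase i _ (mem_of_mem_erase h)) (notMem_erase k _) hki.symm).trans ?_
        rw [ENNReal.ofReal_mul (by positivity)]
        gcongr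
        refine h₂ n m _ hm (by omega) ?_
        rw [card_erase_of_mem hk, card_erase_of_mem (mem_univ i), card_fin]
        omega
      · rw [nsmul_eq_mul]
        gcongr
        exact (card_le_univ _).trans_eq (card_fin n)
  rw [lintegral_finsetSum _ fun i _ =>
    (hm1 (univ.erase i) i).fun_add (Finset.measurable_fun_sum _ fun k _ => hm2 _ i k)]
  refine (Finset.sum_le_card_nsmul _ _ _ fun i _ => hsum i).trans ?_
  rw [card_fin, nsmul_eq_mul, ← ENNReal.ofReal_natCast, ← ENNReal.ofReal_mul hn0.le]
  refine ENNReal.ofReal_le_ofReal ?_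
  -- One factor `u` is absorbed by `n`; the surplus exponent `β / d` is dropped since `u ≤ 1`.
  have e1 : n * u ^ ((d + β + 2) / d) ≤ m * u ^ ((2 : ℝ) / d) := by
    have : u ^ ((d + β + 2) / d) = u * u ^ ((β + 2) / d) := by
      rw [← Real.rpow_one_add' hu0.le (by positivity)]
      congr 1
      field_simp
      ring
    rw [this, ← mul_assoc, hmu]
    gcongr ?_ * ?_
    refine Real.rpow_le_rpow_of_exponent_ge hu0 hu1 ?_
    gcongr
    linarith
  have e2 : n * (n * u ^ ((2 * (d + β) + 2) / d)) = m ^ 2 * u ^ (2 * (β + 1) / d) := by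
    have : u ^ ((2 * (d + β) + 2) / d) = u * (u * u ^ (2 * (β + 1) / d)) := by
      rw [← Real.rpow_one_add' hu0.le (by positivity), ← Real.rpow_one_add' hu0.le (by positivity)]
      congr 1
      field_simp
      ring
    rw [this, ← hmu]
    ring
  have p1 : 0 ≤ m * u ^ ((2 : ℝ) / d) := by positivity
  have p2 : 0 ≤ m ^ 2 * u ^ (2 * (β + 1) / d) := by positivity
  calc _ = K * C₁ * (n * u ^ ((d + β + 2) / d)) +
        K ^ 2 * C₂ * (n * (n * u ^ ((2 * (d + β) + 2) / d))) := by ring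
    _ ≤ K * C₁ * (m * u ^ ((2 : ℝ) / d)) + K ^ 2 * C₂ * (m ^ 2 * u ^ (2 * (β + 1) / d)) := by
        rw [e2]; gcongr
    _ ≤ _ := by
        have : 0 ≤ K * C₁ := by positivity
        have : 0 ≤ K ^ 2 * C₂ := by positivity
        nlinarith [mul_nonneg ‹0 ≤ K * C₁› p2, mul_nonneg ‹0 ≤ K ^ 2 * C₂› p1]

theorem add_add_sq_le (x y z : ℝ) : (x + y + z) ^ 2 ≤ 3 * (x ^ 2 + y ^ 2 + z ^ 2) := by
  nlinarith [sq_nonneg (x - y), sq_nonneg (y - z), sq_nonneg (x - z)]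

theorem exists_lintegral_norm_sq_sum_le {E F : Type*} [MeasurableSpace E]
    [NormedAddCommGroup F] [InnerProductSpace ℝ F] [MeasurableSpace F] [BorelSpace F]
    [SecondCountableTopology F] {ν : Measure E} [IsProbabilityMeasure ν]
    {Y : E → F} (hY : Measurable Y) {d : ℕ} (hd : 1 ≤ d) {c β K R ρ : ℝ} (hc : 0 ≤ c)
    (hβ : 0 < β) (hK : 0 ≤ K) (hR : 0 ≤ R) (hρ : 0 < ρ) {φ : E → E} (hφ : MeasurePreserving φ ν ν)
    (hYφ : ∀ y, ‖Y (φ y)‖ = ‖Y y‖) (hYφ' : ∀ y, ‖Y y‖ ≤ ρ → Y (φ y) = -Y y)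
    (hYR : ∀ᵐ y ∂ν, ‖Y y‖ ≤ R)
    (hann : ∀ q, 0 < q → ν.real {y | q ≤ ‖Y y‖ ∧ ‖Y y‖ ≤ q + c * q ^ (β + 1)} ≤ K * q ^ (d + β))
    (hmom : ∀ p : ℝ, 0 < p → ∃ C > 0, ∀ (n m : ℕ) (A : Finset (Fin n)),
      1 ≤ m → 1 ≤ n → n ≤ 2 * #A →
      ∫⁻ x, ENNReal.ofReal ((ordStat A m fun j => ‖Y (x j)‖) ^ p)
        ∂(Measure.pi fun _ : Fin n => ν) ≤
        ENNReal.ofReal (C * ((m : ℝ) / n) ^ (p / d)))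
    {f : E → ℝ} {s : Set E} (hs : ∀ᵐ y ∂ν, y ∈ s)
    (hf : ∀ x ∈ s, ∀ y ∈ s, f x ≤ f y → ‖Y x‖ ≤ ‖Y y‖ + c * ‖Y y‖ ^ (β + 1)) :
    ∃ C > 0, ∀ n m : ℕ, 4 ≤ n → 1 ≤ m → m ≤ n → ∀ S : (Fin n → E) → Finset (Fin n),
      (∀ x, #(S x) = m) →
      (∀ x, (∀ i, x i ∈ s) → ∀ i ∈ S x, ∀ j, j ∉ S x → f (x i) ≤ f (x j)) →
      ∫⁻ x, ENNReal.ofReal (‖∑ i ∈ S x, Y (x i)‖ ^ 2) ∂(Measure.pi fun _ : Fin n => ν) ≤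
        ENNReal.ofReal (C * (m ^ 2 * ((m : ℝ) / n) ^ (2 * (β + 1) / d) +
          m * ((m : ℝ) / n) ^ ((2 : ℝ) / d))) := by
  have hd' : (0 : ℝ) < d := by exact_mod_cast hd
  obtain ⟨C₀, hC₀, hsum⟩ := exists_lintegral_annulus_sum_le hY.norm hd hβ hK hann hmom
  obtain ⟨C₁, hC₁, h₁⟩ := hmom 2 (by norm_num)
  obtain ⟨C₂, hC₂, h₂⟩ := hmom (2 * (β + 1)) (by positivity)
  set k := 2 * (1 + c * R ^ β)
  have hk : 0 ≤ k := by positivity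
  refine ⟨3 * (C₁ + ((ρ ^ β)⁻¹ ^ 2 * C₂ + k ^ 2 * C₀)), by positivity,
    fun n m hn hm hmn S hS hSf => ?_⟩
  have hn0 : (0 : ℝ) < n := by positivity
  have hm0 : (0 : ℝ) < m := by positivity
  set u := (m : ℝ) / n
  have hu0 : 0 < u := by positivity
  set π := Measure.pi fun _ : Fin n => ν
  set a : E → ℝ := fun y => ‖Y y‖
  have ham : Measurable a := hY.norm
  -- The cut-off makes `Z` odd under `φ` everywhere and bounded, as the orthogonality argument
  -- requires.
  let Z : E → F := fun y => if a y ≤ ρ then Y y else 0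
  have hZm : Measurable Z := Measurable.ite (measurableSet_le ham measurable_const) hY
    measurable_const
  have hZa : ∀ y, ‖Z y‖ ≤ a y := by
    intro y; simp only [Z]; split_ifs
    · exact le_rfl
    · simp [a]
  have hZρ : ∀ y, ‖Z y‖ ≤ ρ := by
    intro y; simp only [Z]; split_ifs with h
    · exact h
    · simp [hρ.le]
  have hZφ : ∀ y, Z (φ y) = -Z y := by
    intro y
    simp only [Z, a, hYφ]
    split_ifs with h
    · exact hYφ' y h
    · simp
  set q : (Fin n → E) → ℝ := fun x => ordStat univ m fun j => a (x j)
  have hq0 : ∀ x, 0 ≤ q x := fun x => ordStat_nonneg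
  have hqm : Measurable q := measurable_ordStat_sample ham univ
  set T : (Fin n → E) → Finset (Fin n) := fun x => bestSet m fun j => a (x j)
  have hT : ∀ x, #(T x) = m := fun x => card_filter_perm_lt _ hmn
  have hTm : ∀ i, MeasurableSet {x : Fin n → E | i ∈ bestSet m fun j => a (x j)} := fun i =>
    measurableSet_mem_bestSet (fun j => ham.comp (measurable_pi_apply j)) i
  set A : (Fin n → E) → ℝ := fun x => ‖∑ i ∈ T x, Z (x i)‖
  set G : (Fin n → E) → ENNReal := fun x =>
    ∑ i, (annulusInd c β m (univ.erase i) i (fun j => a (x j)) *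
          ENNReal.ofReal ((ordStat (univ.erase i) m fun j => a (x j)) ^ 2) +
        ∑ k ∈ univ.erase i, annulusInd c β m ((univ.erase i).erase k) i (fun j => a (x j)) *
          (ENNReal.ofReal ((ordStat ((univ.erase i).erase k) m fun j => a (x j)) ^ 2) *
          annulusInd c β m ((univ.erase i).erase k) k fun j => a (x j)))
  -- the symmetric selection
  have hAm : Measurable A :=
    (measurable_sum_mem (fun i => hZm.comp (measurable_pi_apply i)) hTm).norm
  have hAle : ∀ x, A x ≤ m * ρ := by
    intro x
    refine (norm_sum_le _ _).trans ((sum_le_card_nsmul _ _ ρ fun i _ => hZρ _).trans_eq ?_)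
    rw [hT, nsmul_eq_mul]
  have hAint : Integrable (fun x => A x ^ 2) π := by
    refine Integrable.of_bound (hAm.pow_const 2).aestronglyMeasurable ((m * ρ) ^ 2)
      (ae_of_all _ fun x => ?_)
    rw [Real.norm_of_nonneg (by positivity)]
    exact pow_le_pow_left₀ (norm_nonneg _) (hAle x) 2
  have hsqm : Measurable fun x : Fin n → E => ∑ i ∈ bestSet m fun j => a (x j), ‖Z (x i)‖ ^ 2 :=
    measurable_sum_mem (fun i => (hZm.comp (measurable_pi_apply i)).norm.pow_const 2) hTm
  have hA : ∫⁻ x, ENNReal.ofReal (A x ^ 2) ∂π ≤ ENNReal.ofReal (m * (C₁ * u ^ ((2 : ℝ) / d))) := by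
    rw [← ofReal_integral_eq_lintegral_ofReal hAint (ae_of_all _ fun x => sq_nonneg _),
      integral_norm_sq_sum_eq_of_reflection hφ (a := a) hYφ hZm hZφ hZρ hTm]
    rw [integral_eq_lintegral_of_nonneg_ae (ae_of_all _ fun x => sum_nonneg fun i _ => sq_nonneg _)
      hsqm.aestronglyMeasurable]
    refine ENNReal.ofReal_toReal_le.trans ?_
    calc _ ≤ ∫⁻ x, ENNReal.ofReal m * ENNReal.ofReal (q x ^ (2 : ℝ)) ∂π := by
          refine lintegral_mono fun x => ?_
          rw [← ENNReal.ofReal_mul hm0.le]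
          refine ENNReal.ofReal_le_ofReal ?_
          refine (sum_le_card_nsmul _ _ (q x ^ 2) fun i hi => ?_).trans_eq ?_
          · refine pow_le_pow_left₀ (norm_nonneg _) ((hZa _).trans ?_) 2
            exact le_ordStat_of_lower (a := fun j => a (x j)) (subset_univ _) (hT x)
              (fun i hi j _ hj => le_of_mem_bestSet hi hj) hi
          · rw [hT x, nsmul_eq_mul, Real.rpow_two]
      _ ≤ _ := by
          rw [lintegral_const_mul' _ _ ENNReal.ofReal_ne_top, ENNReal.ofReal_mul hm0.le]
          gcongr
          refine h₁ n m univ hm (by omega) ?_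
          rw [card_fin]; omega
  have hB : ∫⁻ x, ENNReal.ofReal ((m * q x * (q x / ρ) ^ β) ^ 2) ∂π ≤
      ENNReal.ofReal (m ^ 2 * (ρ ^ β)⁻¹ ^ 2 * (C₂ * u ^ (2 * (β + 1) / d))) := by
    have : ∀ x, (m * q x * (q x / ρ) ^ β) ^ 2 =
        m ^ 2 * (ρ ^ β)⁻¹ ^ 2 * q x ^ (2 * (β + 1)) := by
      intro x
      rw [Real.div_rpow (hq0 x) hρ.le, mul_comm 2 (β + 1), Real.rpow_mul (hq0 x), Real.rpow_two,
        Real.rpow_add_one' (hq0 x) (by positivity)]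
      ring
    simp only [this]
    simp only [ENNReal.ofReal_mul (show (0 : ℝ) ≤ m ^ 2 * (ρ ^ β)⁻¹ ^ 2 by positivity)]
    rw [lintegral_const_mul' _ _ ENNReal.ofReal_ne_top]
    gcongr
    refine h₂ n m univ hm (by omega) ?_
    rw [card_fin]; omega
  have hG := hsum n m hn hm hmn
  have hae : ∀ᵐ x ∂π, (∀ j, x j ∈ s) ∧ ∀ j, ‖Y (x j)‖ ≤ R := by
    refine (ae_all_iff.2 fun j => ?_).and (ae_all_iff.2 fun j => ?_)
    · exact (measurePreserving_eval (fun _ : Fin n => ν) j).quasiMeasurePreserving.ae hs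
    · exact (measurePreserving_eval (fun _ : Fin n => ν) j).quasiMeasurePreserving.ae hYR
  calc ∫⁻ x, ENNReal.ofReal (‖∑ i ∈ S x, Y (x i)‖ ^ 2) ∂π
      ≤ ∫⁻ x, ENNReal.ofReal 3 * (ENNReal.ofReal (A x ^ 2) +
          (ENNReal.ofReal ((m * q x * (q x / ρ) ^ β) ^ 2) + ENNReal.ofReal (k ^ 2) * G x)) ∂π := by
        refine lintegral_mono_ae (hae.mono fun x hx => ?_)
        obtain ⟨hxs, hxR⟩ := hx
        have h1 := norm_sum_le_of_selection (φ := fun j => f (x j)) (Y := fun j => Y (x j))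
          hc hβ hρ hR hxR hmn (hS x) (hSf x hxs)
          (fun i j hij => hf _ (hxs i) _ (hxs j) hij)
        have h2 := ofReal_card_sdiff_mul_sq_le (a := fun j => a (x j)) (φ := fun j => f (x j))
          hc hβ.le (fun j => norm_nonneg _) hmn (hS x) (hSf x hxs)
          (fun i j hij => hf _ (hxs i) _ (hxs j) hij)
        have h3 := (pow_le_pow_left₀ (norm_nonneg _) h1 2).trans (add_add_sq_le _ _ _)
        refine (ENNReal.ofReal_le_ofReal h3).trans ?_
        rw [ENNReal.ofReal_mul (by norm_num), ENNReal.ofReal_add (by positivity) (by positivity),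
          ENNReal.ofReal_add (by positivity) (by positivity), mul_pow k,
          ENNReal.ofReal_mul (p := k ^ 2) (by positivity), add_assoc]
        gcongr
    _ ≤ ENNReal.ofReal 3 * (ENNReal.ofReal (m * (C₁ * u ^ ((2 : ℝ) / d))) +
          (ENNReal.ofReal (m ^ 2 * (ρ ^ β)⁻¹ ^ 2 * (C₂ * u ^ (2 * (β + 1) / d))) +
            ENNReal.ofReal (k ^ 2) * ENNReal.ofReal (C₀ * (m ^ 2 * u ^ (2 * (β + 1) / d) +
              m * u ^ ((2 : ℝ) / d))))) := by
        rw [lintegral_const_mul' _ _ ENNReal.ofReal_ne_top,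
          lintegral_add_left (hAm.pow_const 2).ennreal_ofReal,
          lintegral_add_left (by fun_prop), lintegral_const_mul' _ _ ENNReal.ofReal_ne_top]
        gcongr
    _ ≤ _ := by
        rw [← ENNReal.ofReal_mul (by positivity), ← ENNReal.ofReal_add (by positivity)
          (by positivity), ← ENNReal.ofReal_add (by positivity) (by positivity),
          ← ENNReal.ofReal_mul (by positivity)]
        refine ENNReal.ofReal_le_ofReal ?_
        have p1 : 0 ≤ m * u ^ ((2 : ℝ) / d) := by positivity
        have p2 : 0 ≤ m ^ 2 * u ^ (2 * (β + 1) / d) := by positivity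
        have p3 : 0 ≤ (ρ ^ β)⁻¹ ^ 2 * C₂ := by positivity
        nlinarith [mul_nonneg p3 p1, mul_nonneg hC₁.le p2]

end MuBest

namespace MuBest

open MeasureTheory Finset

/-! ### The mean of the selected points -/

section Selection

variable {d n m : ℕ} {r : ℝ} {f : EuclideanSpace ℝ (Fin d) → ℝ}
  {σ : (Fin n → EuclideanSpace ℝ (Fin d)) → Equiv.Perm (Fin n)}

theorem bestMean_eq_sum (x : Fin n → EuclideanSpace ℝ (Fin d)) :
    bestMean σ m x = (m : ℝ)⁻¹ • ∑ j with ((σ x).symm j : ℕ) < m, x j := by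
  unfold bestMean
  congr 1
  exact sum_equiv (σ x) (by simp) (by simp)

theorem bestMean_sub (hm : 1 ≤ m) (hmn : m ≤ n) (x : Fin n → EuclideanSpace ℝ (Fin d))
    (xs : EuclideanSpace ℝ (Fin d)) :
    bestMean σ m x - xs = (m : ℝ)⁻¹ • ∑ j with ((σ x).symm j : ℕ) < m, (x j - xs) := by
  have hm0 : (m : ℝ) ≠ 0 := by positivity
  rw [bestMean_eq_sum, sum_sub_distrib, sum_const, card_filter_perm_lt _ hmn, smul_sub,
    ← Nat.cast_smul_eq_nsmul ℝ, inv_smul_smul₀ hm0]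

theorem ae_forall_mem_closedBall (hr : 0 < r) :
    ∀ᵐ x ∂(sampleLaw d r n), ∀ i, x i ∈ Metric.closedBall 0 r := by
  have := isProbabilityMeasure_uniformBall (d := d) hr
  exact ae_all_iff.2 fun j => (measurePreserving_eval
    (fun _ : Fin n => uniformBall d r) j).quasiMeasurePreserving.ae (ae_mem_closedBall d r)

theorem bestMean_mem_closedBall (hm : 1 ≤ m) (hmn : m ≤ n)
    {x : Fin n → EuclideanSpace ℝ (Fin d)} (hx : ∀ i, x i ∈ Metric.closedBall 0 r) :
    bestMean σ m x ∈ Metric.closedBall 0 r := by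
  have hm0 : (0 : ℝ) < m := by positivity
  rw [bestMean_eq_sum, mem_closedBall_zero_iff, norm_smul, norm_inv, Real.norm_natCast,
    inv_mul_le_iff₀ hm0]
  refine (norm_sum_le _ _).trans ((sum_le_card_nsmul _ _ r fun i _ =>
    mem_closedBall_zero_iff.1 (hx i)).trans_eq ?_)
  rw [card_filter_perm_lt _ hmn, nsmul_eq_mul]

theorem IsRanking.le_of_selected (hσ : IsRanking r f n σ)
    {x : Fin n → EuclideanSpace ℝ (Fin d)} (hx : ∀ i, x i ∈ Metric.closedBall 0 r) {i j : Fin n}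
    (hi : i ∈ ({j | ((σ x).symm j : ℕ) < m} : Finset (Fin n)))
    (hj : j ∉ ({j | ((σ x).symm j : ℕ) < m} : Finset (Fin n))) : f (x i) ≤ f (x j) := by
  simp only [mem_filter, mem_univ, true_and] at hi hj
  have := hσ.sorted x hx (a := (σ x).symm i) (b := (σ x).symm j) (Fin.le_def.2 (by omega))
  simpa using this

theorem IsRanking.integrable_bestMean (hσ : IsRanking r f n σ) (hr : 0 < r)
    (hf : ContinuousOn f (Metric.closedBall 0 r)) (hm : 1 ≤ m) (hmn : m ≤ n) :
    Integrable (fun x => f (bestMean σ m x)) (sampleLaw d r n) := by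
  have := isProbabilityMeasure_uniformBall (d := d) hr
  have : IsProbabilityMeasure (sampleLaw d r n) := by unfold sampleLaw; infer_instance
  have hmem : ∀ᵐ x ∂(sampleLaw d r n), bestMean σ m x ∈ Metric.closedBall 0 r :=
    (ae_forall_mem_closedBall hr).mono fun x hx => bestMean_mem_closedBall hm hmn hx
  obtain ⟨B, hB⟩ := (isCompact_closedBall (0 : EuclideanSpace ℝ (Fin d)) r).exists_bound_of_continuousOn hf
  have hmeas : AEMeasurable (bestMean σ m) (sampleLaw d r n) :=
    AEMeasurable.const_smul (Finset.aemeasurable_fun_sum _ fun i _ => hσ.aemeasurable i) (m : ℝ)⁻¹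
  -- Only the values of `f` on the ball are controlled, so `f` is replaced by its extension by zero,
  -- which is measurable.
  have hfm : Measurable ((Metric.closedBall (0 : EuclideanSpace ℝ (Fin d)) r).indicator f) := by
    classical
    rw [← Set.piecewise_eq_indicator]
    exact hf.measurable_piecewise continuousOn_const measurableSet_closedBall
  have hfae : (fun x => (Metric.closedBall (0 : EuclideanSpace ℝ (Fin d)) r).indicator f
      (bestMean σ m x)) =ᵐ[sampleLaw d r n] fun x => f (bestMean σ m x) :=
    hmem.mono fun x hx => Set.indicator_of_mem hx f
  refine Integrable.of_bound ((hfm.comp_aemeasurable hmeas).congr hfae).aestronglyMeasurable B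
    (hmem.mono fun x hx => hB _ hx)

end Selection

variable {d : ℕ} {r : ℝ} {f : EuclideanSpace ℝ (Fin d) → ℝ} {xs : EuclideanSpace ℝ (Fin d)}
  {H : Matrix (Fin d) (Fin d) ℝ} {α : ℝ}

theorem IsObjective.nonneg (hf : IsObjective r f xs H α) {x : EuclideanSpace ℝ (Fin d)}
    (hx : x ∈ Metric.closedBall 0 r) : 0 ≤ f x := by
  obtain ⟨ε, -, hε⟩ := hf.expansion
  have hα := hf.two_lt
  have h0 : f xs = 0 := by
    rw [hε xs (mem_closedBall_zero_iff.2 hf.norm_lt.le)]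
    simp [sqNormH, Real.zero_rpow (show α / 2 ≠ 0 by linarith)]
  rcases eq_or_ne x xs with rfl | h
  · exact h0.ge
  · exact h0.ge.trans (hf.unique_min x hx h).le

theorem IsObjective.expectedValue_nonneg (hf : IsObjective r f xs H α) {n m : ℕ} (hm : 1 ≤ m)
    (hmn : m ≤ n) (σ : (Fin n → EuclideanSpace ℝ (Fin d)) → Equiv.Perm (Fin n)) :
    0 ≤ expectedValue r f σ m :=
  integral_nonneg_of_ae ((ae_forall_mem_closedBall ((norm_nonneg _).trans_lt hf.norm_lt)).mono
    fun _ hx => hf.nonneg (bestMean_mem_closedBall hm hmn hx))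

/-! ### Upper bound at the mean, lower bound for random search -/

/-- The bound on the expected value at the mean of the best points. -/
theorem IsObjective.exists_expectedValue_le (hf : IsObjective r f xs H α) (hd : 1 ≤ d) :
    ∃ C > 0, ∀ n m : ℕ, 4 ≤ n → 1 ≤ m → m ≤ n →
      ∀ σ : (Fin n → EuclideanSpace ℝ (Fin d)) → Equiv.Perm (Fin n), IsRanking r f n σ →
        expectedValue r f σ m ≤ C * (((m : ℝ) / n) ^ (2 * (α - 1) / d)) +
          C * (((m : ℝ) / n) ^ ((2 : ℝ) / d) / m) := by
  have hr : 0 < r := (norm_nonneg _).trans_lt hf.norm_lt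
  have := isProbabilityMeasure_uniformBall (d := d) hr
  have hα := hf.two_lt
  obtain ⟨L, hL⟩ := exists_sqNormH_eq_norm_sq hf.posDef
  obtain ⟨V, hV, κ, hκ, R, hR, ρ, hρ, hρball, hRball, hκF, -, hann⟩ :=
    exists_uniformBall_ellipsoid_bounds L hf.norm_lt
  obtain ⟨-, -, c₁, hc₁, c, hc, -, hup, hcomp⟩ := hf.exists_comparison hL hR hRball
  set Y : EuclideanSpace ℝ (Fin d) → EuclideanSpace ℝ (Fin d) := fun x => L (x - xs)
  have hY : Measurable Y := by fun_prop
  have hYR : ∀ᵐ y ∂(uniformBall d r), ‖Y y‖ ≤ R :=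
    (ae_mem_closedBall d r).mono fun x hx => hRball x hx
  have hβ : α - 2 + 1 = α - 1 := by ring
  obtain ⟨K, hK, hKann⟩ := exists_annulus_le hd (β := α - 2) hc.le hR hV (by linarith) hYR hann
  obtain ⟨C, hC, hmain⟩ := exists_lintegral_norm_sq_sum_le (ν := uniformBall d r) hY hd
    (β := α - 2) hc.le (by linarith) hK.le hR.le hρ
    (measurePreserving_ellipsoidReflection hρball) norm_map_ellipsoidReflection
    (fun y hy => by
      have : ellipsoidReflection L xs ρ y = xs + xs - y := Set.piecewise_eq_of_mem _ _ _ hy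
      simp only [Y, this]
      rw [show xs + xs - y - xs = -(y - xs) by abel, map_neg])
    hYR hKann
    (fun p hp => exists_ordStat_moment_le hY.norm hd hκ hR.le hYR hκF hp)
    (ae_mem_closedBall d r) (by rw [hβ]; exact hcomp)
  rw [hβ] at hmain
  refine ⟨c₁ * C, by positivity, fun n m hn hm hmn σ hσ => ?_⟩
  have hm0 : (0 : ℝ) < m := by positivity
  have hn0 : (0 : ℝ) < n := by positivity
  have hmem := ae_forall_mem_closedBall (d := d) (n := n) hr
  have hmean : ∀ᵐ x ∂(sampleLaw d r n), bestMean σ m x ∈ Metric.closedBall 0 r :=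
    hmem.mono fun x hx => bestMean_mem_closedBall hm hmn hx
  have h := hmain n m hn hm hmn (fun x => {j | ((σ x).symm j : ℕ) < m})
    (fun x => card_filter_perm_lt _ hmn) (fun x hx i hi j hj => hσ.le_of_selected hx hi hj)
  rw [expectedValue, integral_eq_lintegral_of_nonneg_ae (hmean.mono fun x hx => hf.nonneg hx)
    (hσ.integrable_bestMean hr hf.continuousOn hm hmn).aestronglyMeasurable]
  set u := (m : ℝ) / n
  have hu0 : 0 < u := by positivity
  refine ENNReal.toReal_le_of_le_ofReal (by positivity) ?_
  calc ∫⁻ x, ENNReal.ofReal (f (bestMean σ m x)) ∂(sampleLaw d r n)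
      ≤ ∫⁻ x, ENNReal.ofReal (c₁ * (m ^ 2 : ℝ)⁻¹) *
          ENNReal.ofReal (‖∑ i with ((σ x).symm i : ℕ) < m, Y (x i)‖ ^ 2) ∂(sampleLaw d r n) := by
        refine lintegral_mono_ae (hmean.mono fun x hx => ?_)
        rw [← ENNReal.ofReal_mul (by positivity)]
        refine ENNReal.ofReal_le_ofReal ((hup _ hx).trans_eq ?_)
        rw [bestMean_sub hm hmn, map_smul, map_sum, norm_smul, norm_inv, Real.norm_natCast]
        ring
    _ ≤ ENNReal.ofReal (c₁ * (m ^ 2 : ℝ)⁻¹) * ENNReal.ofReal (C *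
          (m ^ 2 * u ^ (2 * (α - 1) / d) + m * u ^ ((2 : ℝ) / d))) := by
        rw [lintegral_const_mul' _ _ ENNReal.ofReal_ne_top]
        gcongr
        exact h
    _ = _ := by
        rw [← ENNReal.ofReal_mul (by positivity)]
        congr 1
        field_simp

/-- The expected value reached by random search is at least of order `n^{-2/d}`. -/
theorem IsObjective.exists_le_expectedValue_one (hf : IsObjective r f xs H α) (hd : 1 ≤ d) :
    ∃ c > 0, ∀ n : ℕ, 1 ≤ n →
      ∀ σ : (Fin n → EuclideanSpace ℝ (Fin d)) → Equiv.Perm (Fin n), IsRanking r f n σ →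
        c * (n : ℝ) ^ (-((2 : ℝ) / d)) ≤ expectedValue r f σ 1 := by
  have hr : 0 < r := (norm_nonneg _).trans_lt hf.norm_lt
  have := isProbabilityMeasure_uniformBall (d := d) hr
  have hd' : (0 : ℝ) < d := by exact_mod_cast hd
  obtain ⟨L, hL⟩ := exists_sqNormH_eq_norm_sq hf.posDef
  obtain ⟨V, hV, κ, hκ, R, hR, ρ, hρ, hρball, hRball, -, hVF, -⟩ :=
    exists_uniformBall_ellipsoid_bounds L hf.norm_lt
  obtain ⟨c₀, hc₀, -, -, -, -, hlow, -, -⟩ := hf.exists_comparison hL hR hRball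
  refine ⟨c₀ / 2 * (1 / (2 * V)) ^ ((2 : ℝ) / d), by positivity, fun n hn σ hσ => ?_⟩
  have hn0 : (0 : ℝ) < n := by positivity
  have : IsProbabilityMeasure (sampleLaw d r n) := by unfold sampleLaw; infer_instance
  -- Chosen so that the ellipsoid of radius `t` has mass at most `1 / (2n)`; by Bernoulli's
  -- inequality all `n` points miss it with probability at least `1/2`.
  set t : ℝ := (1 / (2 * V) * (n : ℝ)⁻¹) ^ (1 / d : ℝ)
  have ht0 : 0 ≤ t := by positivity
  have htd : V * t ^ d = 1 / (2 * n) := by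
    rw [← Real.rpow_natCast, ← Real.rpow_mul (by positivity), one_div_mul_cancel hd'.ne',
      Real.rpow_one]
    field_simp
  have ht2 : t ^ 2 = (1 / (2 * V)) ^ ((2 : ℝ) / d) * (n : ℝ) ^ (-((2 : ℝ) / d)) := by
    rw [← Real.rpow_two, ← Real.rpow_mul (by positivity), Real.rpow_neg hn0.le,
      ← Real.inv_rpow hn0.le, ← Real.mul_rpow (by positivity) (by positivity)]
    congr 1
    ring
  have hms : MeasurableSet {y : EuclideanSpace ℝ (Fin d) | t < ‖L (y - xs)‖} :=
    measurableSet_lt measurable_const (by fun_prop)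
  set Ω : Set (Fin n → EuclideanSpace ℝ (Fin d)) := Set.univ.pi fun _ => {y | t < ‖L (y - xs)‖}
  have hΩm : MeasurableSet Ω := MeasurableSet.univ_pi fun _ => hms
  have hΩ : 1 / 2 ≤ (sampleLaw d r n).real Ω := by
    have h1 : (sampleLaw d r n).real Ω =
        (uniformBall d r).real {y | t < ‖L (y - xs)‖} ^ n := by
      rw [Measure.real, sampleLaw, Measure.pi_pi, prod_const, card_fin, ENNReal.toReal_pow]
      rfl
    have h2 : (uniformBall d r).real {y | t < ‖L (y - xs)‖} =
        1 - (uniformBall d r).real {y | ‖L (y - xs)‖ ≤ t} := by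
      rw [← probReal_compl_eq_one_sub (measurableSet_le (by fun_prop) measurable_const)]
      congr 1
      ext y; simp
    have h3 := hVF t ht0
    rw [htd] at h3
    have h4 : (1 : ℝ) / (2 * n) ≤ 1 := by
      rw [div_le_one (by positivity)]
      have : (1 : ℝ) ≤ n := by exact_mod_cast hn
      linarith
    have h5 := one_add_mul_le_pow (a := -(1 / (2 * n : ℝ))) (by linarith) n
    rw [h1, h2]
    calc (1 : ℝ) / 2 = 1 + n * -(1 / (2 * n : ℝ)) := by field_simp; norm_num
      _ ≤ (1 + -(1 / (2 * n : ℝ))) ^ n := h5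
      _ ≤ _ := pow_le_pow_left₀ (by linarith) (by linarith) n
  have hmem := ae_forall_mem_closedBall (d := d) (n := n) hr
  have hint := hσ.integrable_bestMean hr hf.continuousOn le_rfl hn
  calc c₀ / 2 * (1 / (2 * V)) ^ ((2 : ℝ) / d) * (n : ℝ) ^ (-((2 : ℝ) / d))
      = c₀ * t ^ 2 * (1 / 2) := by rw [ht2]; ring
    _ ≤ c₀ * t ^ 2 * (sampleLaw d r n).real Ω := by gcongr
    _ = ∫ x, Ω.indicator (fun _ => c₀ * t ^ 2) x ∂(sampleLaw d r n) := by
        rw [integral_indicator hΩm, setIntegral_const, smul_eq_mul, mul_comm]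
    _ ≤ expectedValue r f σ 1 := by
        refine integral_mono_ae ((integrable_const _).indicator hΩm) hint (hmem.mono fun x hx => ?_)
        have hball := bestMean_mem_closedBall (σ := σ) le_rfl hn hx
        have hb := hlow _ hball
        by_cases hxΩ : x ∈ Ω
        · simp only [Set.indicator_of_mem hxΩ]
          refine le_trans ?_ hb
          have hmean : bestMean σ 1 x = x (σ x ⟨0, hn⟩) := by
            have : (univ.filter fun i : Fin n => (i : ℕ) < 1) = {⟨0, hn⟩} := by
              ext i; simp [Fin.ext_iff]
            rw [bestMean, this]; simp
          rw [hmean]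
          have : t < ‖L (x (σ x ⟨0, hn⟩) - xs)‖ := hxΩ _ (Set.mem_univ _)
          gcongr
        · simp only [Set.indicator_of_notMem hxΩ]
          exact le_trans (by positivity) hb

end MuBest

namespace MuBest

open Filter Asymptotics

/-! ### Asymptotics of powers -/

theorem exists_rpow_div_rpow_le {u : ℕ → ℝ} {C γ s t e : ℝ} (hC : 0 < C)
    (hu : IsEquivalent atTop u fun n : ℕ => C * (n : ℝ) ^ γ) (he : γ * s - t = -e) :
    ∃ B, ∀ n : ℕ, 1 ≤ n → u n ^ s / (n : ℝ) ^ t ≤ B * (n : ℝ) ^ (-e) := by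
  have h1 : (fun n : ℕ => u n ^ s) =O[atTop] fun n : ℕ => (C * (n : ℝ) ^ γ) ^ s :=
    (hu.rpow fun n => by positivity).isBigO
  have h2 : (fun n : ℕ => u n ^ s * ((n : ℝ) ^ e / (n : ℝ) ^ t)) =O[atTop] fun _ => (1 : ℝ) := by
    refine (h1.mul (isBigO_refl (fun n : ℕ => (n : ℝ) ^ e / (n : ℝ) ^ t) atTop)).trans ?_
    refine EventuallyEq.trans_isBigO (f₂ := fun _ => C ^ s) ?_ (isBigO_const_const _ one_ne_zero _)
    filter_upwards [eventually_ge_atTop 1] with n hn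
    have hn0 : (0 : ℝ) < n := by positivity
    rw [Real.mul_rpow hC.le (by positivity), ← Real.rpow_mul hn0.le, ← Real.rpow_sub hn0, mul_assoc,
      ← Real.rpow_add hn0, show γ * s + (e - t) = 0 by linarith, Real.rpow_zero, mul_one]
  -- On `ℕ`, bounded near infinity means bounded everywhere. A bound for every `n ≥ 1` is needed
  -- because the final threshold is fixed before the constant of the equivalence.
  obtain ⟨B, hB⟩ := isBigO_one_nat_atTop_iff.1 h2
  refine ⟨B, fun n hn => ?_⟩
  have hn0 : (0 : ℝ) < n := by positivity
  rw [Real.rpow_neg hn0.le, ← div_eq_mul_inv, le_div_iff₀ (by positivity)]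
  refine le_trans (le_of_eq ?_) ((le_abs_self _).trans (hB n))
  ring

theorem isLittleO_natCast_rpow {p q : ℝ} (h : p < q) :
    (fun n : ℕ => (n : ℝ) ^ p) =o[atTop] fun n : ℕ => (n : ℝ) ^ q := by
  refine isLittleO_of_tendsto' ?_ ?_
  · filter_upwards [eventually_ge_atTop 1] with n hn h0
    have : (0 : ℝ) < (n : ℝ) ^ q := by positivity
    exact absurd h0 this.ne'
  · refine ((tendsto_rpow_neg_atTop (sub_pos.2 h)).comp tendsto_natCast_atTop_atTop).congr' ?_
    filter_upwards [eventually_ge_atTop 1] with n hn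
    have hn0 : (0 : ℝ) < n := by positivity
    rw [Function.comp, ← Real.rpow_sub hn0, neg_sub]

end MuBest

/-! ### The main theorem -/

theorem theorem1 (d : ℕ) (hd : 1 ≤ d) (r : ℝ) (f : EuclideanSpace ℝ (Fin d) → ℝ)
    (xs : EuclideanSpace ℝ (Fin d)) (H : Matrix (Fin d) (Fin d) ℝ) (α : ℝ)
    (hf : MuBest.IsObjective r f xs H α)
    (μ : ℕ → ℕ) (hμ : ∀ n, 2 ≤ n → 1 ≤ μ n ∧ μ n ≤ n - 1)
    (hμ_lim : Filter.Tendsto μ Filter.atTop Filter.atTop) :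
    ∃ C > (0 : ℝ), ∃ C' > (0 : ℝ), ∃ n₀ : ℕ,
      -- the general bound
      (∀ n ≥ n₀, ∀ σ : (Fin n → EuclideanSpace ℝ (Fin d)) → Equiv.Perm (Fin n),
        MuBest.IsRanking r f n σ →
          MeasureTheory.Integrable (fun x => f (MuBest.bestMean σ (μ n) x))
            (MuBest.sampleLaw d r n) ∧
          MuBest.expectedValue r f σ (μ n) ≤
            C * ((μ n : ℝ) ^ (2 * (α - 1) / d) / (n : ℝ) ^ (2 * (α - 1) / d)) +
            C' * ((μ n : ℝ) ^ ((2 : ℝ) / d - 1) / (n : ℝ) ^ ((2 : ℝ) / d))) ∧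
      -- the choice of the selection size that balances the two terms
      (∀ C₂ > (0 : ℝ),
        Asymptotics.IsEquivalent Filter.atTop (fun n : ℕ => (μ n : ℝ))
          (fun n : ℕ => C₂ * (n : ℝ) ^ (2 * (α - 2) / (d + 2 * (α - 2)))) →
        (∃ C₃ > (0 : ℝ), ∀ n ≥ n₀,
          ∀ σ : (Fin n → EuclideanSpace ℝ (Fin d)) → Equiv.Perm (Fin n),
            MuBest.IsRanking r f n σ →
              MuBest.expectedValue r f σ (μ n) ≤
                C₃ * (n : ℝ) ^ (-(2 * (α - 1) / (d + 2 * (α - 2))))) ∧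
        -- in dimension at least three this is of smaller order than random search
        (2 < d → ∀ σ : (n : ℕ) → (Fin n → EuclideanSpace ℝ (Fin d)) → Equiv.Perm (Fin n),
          (∀ n, MuBest.IsRanking r f n (σ n)) →
            Asymptotics.IsLittleO Filter.atTop
              (fun n : ℕ => MuBest.expectedValue r f (σ n) (μ n))
              (fun n : ℕ => MuBest.expectedValue r f (σ n) 1))) := by
  have hd' : (0 : ℝ) < d := by exact_mod_cast hd
  have hα := hf.two_lt
  have hr : 0 < r := (norm_nonneg _).trans_lt hf.norm_lt
  obtain ⟨C, hC, hle⟩ := hf.exists_expectedValue_le hd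
  have hbound : ∀ n ≥ 4, ∀ σ : (Fin n → EuclideanSpace ℝ (Fin d)) → Equiv.Perm (Fin n),
      MuBest.IsRanking r f n σ → MuBest.expectedValue r f σ (μ n) ≤
        C * ((μ n : ℝ) ^ (2 * (α - 1) / d) / (n : ℝ) ^ (2 * (α - 1) / d)) +
          C * ((μ n : ℝ) ^ ((2 : ℝ) / d - 1) / (n : ℝ) ^ ((2 : ℝ) / d)) := by
    intro n hn σ hσ
    obtain ⟨h1, h2⟩ := hμ n (by omega)
    have hm0 : (0 : ℝ) < μ n := by positivity
    refine (hle n (μ n) hn h1 (by omega) σ hσ).trans_eq ?_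
    rw [Real.div_rpow hm0.le (by positivity), Real.div_rpow hm0.le (by positivity),
      Real.rpow_sub_one hm0.ne', div_right_comm]
  refine ⟨C, hC, C, hC, 4, fun n hn σ hσ => ⟨?_, hbound n hn σ hσ⟩, fun C₂ hC₂ hequiv => ?_⟩
  · obtain ⟨h1, h2⟩ := hμ n (by omega)
    exact hσ.integrable_bestMean hr hf.continuousOn h1 (by omega)
  have hden : 0 < d + 2 * (α - 2) := by linarith
  obtain ⟨C₃, hC₃, hsmall⟩ : ∃ C₃ > (0 : ℝ), ∀ n ≥ 4,
      ∀ σ : (Fin n → EuclideanSpace ℝ (Fin d)) → Equiv.Perm (Fin n), MuBest.IsRanking r f n σ →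
        MuBest.expectedValue r f σ (μ n) ≤
          C₃ * (n : ℝ) ^ (-(2 * (α - 1) / (d + 2 * (α - 2)))) := by
    -- The prescribed growth of `μ` gives both terms the same exponent.
    obtain ⟨B₁, h₁⟩ := MuBest.exists_rpow_div_rpow_le (s := 2 * (α - 1) / d)
      (t := 2 * (α - 1) / d) (e := 2 * (α - 1) / (d + 2 * (α - 2))) hC₂ hequiv (by
        field_simp; ring)
    obtain ⟨B₂, h₂⟩ := MuBest.exists_rpow_div_rpow_le (s := (2 : ℝ) / d - 1)
      (t := (2 : ℝ) / d) (e := 2 * (α - 1) / (d + 2 * (α - 2))) hC₂ hequiv (by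
        field_simp; ring)
    -- The maximum with one secures positivity, the signs of `B₁` and `B₂` being unknown.
    refine ⟨max (C * B₁ + C * B₂) 1, by positivity, fun n hn σ hσ => ?_⟩
    calc _ ≤ _ := hbound n hn σ hσ
      _ ≤ C * (B₁ * (n : ℝ) ^ (-(2 * (α - 1) / (d + 2 * (α - 2))))) +
          C * (B₂ * (n : ℝ) ^ (-(2 * (α - 1) / (d + 2 * (α - 2))))) := by
          gcongr
          · exact h₁ n (by omega)
          · exact h₂ n (by omega)
      _ = (C * B₁ + C * B₂) * (n : ℝ) ^ (-(2 * (α - 1) / (d + 2 * (α - 2)))) := by ring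
      _ ≤ _ := by gcongr; exact le_max_left _ _
  refine ⟨⟨C₃, hC₃, hsmall⟩, fun hd2 σ hσ => ?_⟩
  have hd2' : (2 : ℝ) < d := by exact_mod_cast hd2
  obtain ⟨c, hc, hlow⟩ := hf.exists_le_expectedValue_one hd
  -- After clearing denominators this is `2(α - 2) < d(α - 2)`, which is where `d > 2` enters.
  have hexp : (2 : ℝ) / d < 2 * (α - 1) / (d + 2 * (α - 2)) := by
    rw [div_lt_div_iff₀ hd' hden]
    nlinarith
  have hup : (fun n : ℕ => MuBest.expectedValue r f (σ n) (μ n)) =O[Filter.atTop]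
      fun n : ℕ => (n : ℝ) ^ (-(2 * (α - 1) / (d + 2 * (α - 2)))) := by
    refine Asymptotics.IsBigO.of_bound C₃ ?_
    filter_upwards [Filter.eventually_ge_atTop 4] with n hn
    obtain ⟨h1, h2⟩ := hμ n (by omega)
    rw [Real.norm_of_nonneg (hf.expectedValue_nonneg h1 (by omega) _),
      Real.norm_of_nonneg (by positivity)]
    exact hsmall n hn (σ n) (hσ n)
  have hmid : (fun n : ℕ => (n : ℝ) ^ (-(2 * (α - 1) / (d + 2 * (α - 2))))) =o[Filter.atTop]
      fun n : ℕ => (n : ℝ) ^ (-((2 : ℝ) / d)) :=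
    MuBest.isLittleO_natCast_rpow (neg_lt_neg hexp)
  have hdown : (fun n : ℕ => (n : ℝ) ^ (-((2 : ℝ) / d))) =O[Filter.atTop]
      fun n : ℕ => MuBest.expectedValue r f (σ n) 1 := by
    refine Asymptotics.IsBigO.of_bound c⁻¹ ?_
    filter_upwards [Filter.eventually_ge_atTop 1] with n hn
    have h := hlow n hn (σ n) (hσ n)
    rw [Real.norm_of_nonneg (by positivity), Real.norm_of_nonneg (le_trans (by positivity) h),
      ← div_eq_inv_mul, le_div_iff₀ hc, mul_comm]
    exact h
  exact (hup.trans_isLittleO hmid).trans_isBigO hdown
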